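/- Conventions. For $A,B\in\mathbb C^{n,m}$ the normal rank of the pencil $A-\lambda B$ is $\max_{\zeta\in\mathbb C}\operatorname{rank}(A-\zeta B)$. A number $\lambda_0\in\mathbb C$ (respectively $\lambda_0=\infty$) is an eigenvalue of the pencil if $\operatorname{rank}(A-\lambda_0B)$ (respectively $\operatorname{rank}B$) is smaller than the normal rank. A square pencil is regular if $\det(A-\lambda B)\not\equiv0$; in that case right and left eigenvectors for $\lambda_0\in\mathbb C$ are nonzero vectors $x$, $y$ with $(A-\lambda_0B)x=0$, $y^*(A-\lambda_0B)=0$ (with $Bx=0$, $y^*B=0$ if $\lambda_0=\infty$). Every pencil can be brought by $P(A-\lambda B)Q$ with nonsingular $P,Q$ to its Kronecker canonical form, which is block diagonal with blocks $J_d(\zeta)-\lambda I_d$ ($\zeta\in\mathbb C$) and $I_d-\lambda J_d(0)$ (eigenvalue $\infty$), where $d\ge1$ and $J_d(\zeta)$ is a Jordan block, and blocks $L_j(\lambda)=[0\ I_j]-\lambda[I_j\ 0]$ and $L_j(\lambda)^\top$ with $j\ge0$; the blocks are unique up to their order. The blocks of the first two kinds form the regular part $R(\lambda)$ of the pencil.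 An eigenvalue of a regular pencil is simple if exactly one block of its Kronecker canonical form belongs to it, and that block has size $1$. A set $\Omega\subseteq\mathbb C^{n,p}$ is generic if, under the identification of $\mathbb C^{n,p}$ with $\mathbb R^{2np}$ by real and imaginary parts of the entries, its complement is contained in the set of common zeros of finitely many real polynomials, and this zero set is not all of $\mathbb R^{2np}$. Theorem. Let $A-\lambda B$ be a complex $n\times m$ pencil of normal rank $n-k$, with $n\ge m$, and let $R(\lambda)$ be its regular part. Then there exists a generic set $\Omega\subseteq\mathbb C^{n,n-k}$ such that for each $W\in\Omega$ there exists a generic set $\Omega'\subseteq\mathbb C^{n,n-k}$ such that for all $$\widehat Z=\begin{bmatrix}Z\\ Z'\end{bmatrix}\in\Omega',\qquad Z\in\mathbb C^{m,n-k},\ Z'\in\mathbb C^{n-m,n-k},$$ the following statements hold. 1. The $(n-k)\times(n-k)$ pencil $W^*(A-\lambda B)Z$ is regular and has the Kronecker canonical form $\operatorname{diag}(R(\lambda),R_{\rm ran}(\lambda))$, where all eigenvalues of $R_{\rm ran}(\lambda)$ are simple and distinct from the eigenvalues of $R(\lambda)$. 2. Let the columns of $W_\perp,\widehat Z_\perp\in\mathbb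 C^{n,k}$ form bases of the orthogonal complements of the ranges of $W$ and $\widehat Z$, respectively, and let $Z_\perp\in\mathbb C^{m,k}$ be the upper $m\times k$ submatrix of $\widehat Z_\perp$. Let $\lambda_0\in\mathbb C\cup\{\infty\}$ be an eigenvalue of $W^*(A-\lambda B)Z$ with corresponding left eigenvector $y$ and right eigenvector $x$. If $\lambda_0\in\mathbb C$, then $\lambda_0$ is an eigenvalue of $A-\lambda B$, i.e. of $R(\lambda)$, if and only if $y^*W^*(A-\lambda_0B)Z_\perp=0$ and $W_\perp^*(A-\lambda_0B)Zx=0$. If $\lambda_0=\infty$, then $\lambda_0$ is an eigenvalue of $A-\lambda B$, i.e. of $R(\lambda)$, if and only if $y^*W^*BZ_\perp=0$ and $W_\perp^*BZx=0$. -/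

import Mathlib

open Matrix

noncomputable section

namespace MatrixPencil

/-! ### Generic sets -/

/-- A subset of `ℝ^σ` is algebraic if it is the set of common zeros of finitely many polynomials. -/
def IsAlgebraicSet {σ : Type*} (S : Set (σ → ℝ)) : Prop :=
  ∃ F : Finset (MvPolynomial σ ℝ), S = {x | ∀ p ∈ F, MvPolynomial.eval x p = 0}

/-- A subset of `ℝ^σ` is generic if its complement is contained in a proper algebraic subset. -/
def IsGenericReal {σ : Type*} (Ω : Set (σ → ℝ)) : Prop :=
  ∃ S : Set (σ → ℝ), IsAlgebraicSet S ∧ S ≠ Set.univ ∧ Ωᶜ ⊆ S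

/-- The canonical identification of `ℂ^{n,p}` with `ℝ^{2np}`: the real and the imaginary parts of
the entries. -/
def realCoords {n p : ℕ} (M : Matrix (Fin n) (Fin p) ℂ) :
    (Fin n × Fin p) ⊕ (Fin n × Fin p) → ℝ :=
  Sum.elim (fun ij => (M ij.1 ij.2).re) (fun ij => (M ij.1 ij.2).im)

/-- A set of complex matrices is generic if it is identified with a generic subset of `ℝ^{2np}`. -/
def IsGeneric {n p : ℕ} (Ω : Set (Matrix (Fin n) (Fin p) ℂ)) : Prop :=
  IsGenericReal (realCoords '' Ω)

/-! ### Pencils, normal rank, eigenvalues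

The pencil `A - λ B` is represented by the pair of matrices `A`, `B`. -/

/-- The value of the pencil `A - λ B` at a point of `ℂ ∪ {∞}`: it is `A - ζ B` at `ζ ∈ ℂ`, and
`B` at `∞`. -/
def pencilAt {n m : ℕ} (A B : Matrix (Fin n) (Fin m) ℂ) (μ : OnePoint ℂ) :
    Matrix (Fin n) (Fin m) ℂ :=
  μ.elim B (fun ζ => A - ζ • B)

/-- The normal rank `max_{ζ ∈ ℂ} rank (A - ζ B)` (a supremum of naturals bounded by `n`). -/
def normalRank {n m : ℕ} (A B : Matrix (Fin n) (Fin m) ℂ) : ℕ :=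
  ⨆ ζ : ℂ, (A - ζ • B).rank

/-- A square pencil is regular if `det (A - λ B)` does not vanish identically. -/
def IsRegularPencil {n : ℕ} (A B : Matrix (Fin n) (Fin n) ℂ) : Prop :=
  ∃ ζ : ℂ, (A - ζ • B).det ≠ 0

/-- `μ ∈ ℂ ∪ {∞}` is an eigenvalue of `A - λ B` if the rank drops there below the normal rank. -/
def IsEigenvalue {n m : ℕ} (A B : Matrix (Fin n) (Fin m) ℂ) (μ : OnePoint ℂ) : Prop :=
  (pencilAt A B μ).rank < normalRank A B

/-- Right eigenvectors of a regular pencil: `x ≠ 0` and `(A - μ B) x = 0` (`B x = 0` if `μ = ∞`). -/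
def IsRightEigenvector {n : ℕ} (A B : Matrix (Fin n) (Fin n) ℂ) (μ : OnePoint ℂ)
    (x : Fin n → ℂ) : Prop :=
  x ≠ 0 ∧ pencilAt A B μ *ᵥ x = 0

/-- Left eigenvectors of a regular pencil: `y ≠ 0` and `y* (A - μ B) = 0`
(`y* B = 0` if `μ = ∞`). -/
def IsLeftEigenvector {n : ℕ} (A B : Matrix (Fin n) (Fin n) ℂ) (μ : OnePoint ℂ)
    (y : Fin n → ℂ) : Prop :=
  y ≠ 0 ∧ star y ᵥ* pencilAt A B μ = 0

/-! ### Kronecker canonical form -/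

/-- The Jordan block `J_d(ζ)`. -/
def jordanBlock (ζ : ℂ) (d : ℕ) : Matrix (Fin d) (Fin d) ℂ :=
  Matrix.of fun i j => if i = j then ζ else if (i : ℕ) + 1 = j then 1 else 0

/-- A regular block of a Kronecker canonical form is given by its eigenvalue in `ℂ ∪ {∞}` and its
size `d ≥ 1`. It stands for `J_d(ζ) - λ I` if the eigenvalue is `ζ ∈ ℂ`, and for `I - λ J_d(0)` if
the eigenvalue is `∞`. -/
structure RegularBlock where
  eigenvalue : OnePoint ℂ
  size : ℕ
  size_pos : 0 < size

/-- The blocks of a Kronecker canonical form: regular blocks, right singular blocks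
`L_j(λ) = [0 I_j] - λ [I_j 0]` of size `j × (j+1)`, and left singular blocks `L_j(λ)ᵀ`. -/
inductive KroneckerBlock where
  | regular (b : RegularBlock)
  | right (j : ℕ)
  | left (j : ℕ)

namespace KroneckerBlock

/-- Number of rows of a block. -/
def rows : KroneckerBlock → ℕ
  | regular b => b.size
  | right j => j
  | left j => j + 1

/-- Number of columns of a block. -/
def cols : KroneckerBlock → ℕ
  | regular b => b.size
  | right j => j + 1
  | left j => j

/-- The matrix `E` of a block `E - λ F`. -/
def matE : (b : KroneckerBlock) → Matrix (Fin b.rows) (Fin b.cols) ℂ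
  | regular b => b.eigenvalue.elim (1 : Matrix (Fin b.size) (Fin b.size) ℂ) (fun ζ => jordanBlock ζ b.size)
  | right j => (Matrix.of fun (i : Fin j) (l : Fin (j + 1)) => if l = i.succ then 1 else 0)
  | left j => (Matrix.of fun (l : Fin (j + 1)) (i : Fin j) => if l = i.succ then 1 else 0)

/-- The matrix `F` of a block `E - λ F`. -/
def matF : (b : KroneckerBlock) → Matrix (Fin b.rows) (Fin b.cols) ℂ
  | regular b => b.eigenvalue.elim (jordanBlock 0 b.size)
      (fun _ => (1 : Matrix (Fin b.size) (Fin b.size) ℂ))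
  | right j => (Matrix.of fun (i : Fin j) (l : Fin (j + 1)) => if l = i.castSucc then 1 else 0)
  | left j => (Matrix.of fun (l : Fin (j + 1)) (i : Fin j) => if l = i.castSucc then 1 else 0)

end KroneckerBlock

/-- The list of all blocks with regular part `R`, right minimal indices `rt` and left minimal
indices `lf`. -/
def kroneckerBlocks (R : List RegularBlock) (rt lf : List ℕ) : List KroneckerBlock :=
  R.map KroneckerBlock.regular ++ rt.map KroneckerBlock.right ++ lf.map KroneckerBlock.left

/-- The pencil `A - λ B` has the Kronecker canonical form with regular part `R`, right minimal
indices `rt` and left minimal indices `lf`: there are nonsingular `P`, `Q` such that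
`P (A - λ B) Q` is the block diagonal pencil with these blocks. The bijections `e` and `f` number
the rows and the columns of the block diagonal matrices; the order of the blocks is immaterial. -/
def HasKroneckerForm {n m : ℕ} (A B : Matrix (Fin n) (Fin m) ℂ)
    (R : List RegularBlock) (rt lf : List ℕ) : Prop :=
  let l := kroneckerBlocks R rt lf
  ∃ (e : Fin n ≃ (Σ i : Fin l.length, Fin (l.get i).rows))
    (f : Fin m ≃ (Σ i : Fin l.length, Fin (l.get i).cols))
    (P : Matrix (Fin n) (Fin n) ℂ) (Q : Matrix (Fin m) (Fin m) ℂ),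
    P.det ≠ 0 ∧ Q.det ≠ 0 ∧
    P * A * Q = (Matrix.blockDiagonal' fun i => (l.get i).matE).submatrix e f ∧
    P * B * Q = (Matrix.blockDiagonal' fun i => (l.get i).matF).submatrix e f

/-- `R` is the regular part of `A - λ B` (which is unique up to the order of the blocks). -/
def IsRegularPart {n m : ℕ} (A B : Matrix (Fin n) (Fin m) ℂ) (R : List RegularBlock) : Prop :=
  ∃ rt lf : List ℕ, HasKroneckerForm A B R rt lf

/-- `μ` is an eigenvalue of the regular pencil with blocks `R`. -/
def IsBlockEigenvalue (R : List RegularBlock) (μ : OnePoint ℂ) : Prop :=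
  ∃ b ∈ R, b.eigenvalue = μ

/-- `μ` is a simple eigenvalue of the regular pencil with blocks `R`: exactly one block belongs to
`μ`, and this block has size one. -/
def IsSimpleBlockEigenvalue (R : List RegularBlock) (μ : OnePoint ℂ) : Prop :=
  ∃ i : Fin R.length, (R.get i).size = 1 ∧
    ∀ j : Fin R.length, (R.get j).eigenvalue = μ ↔ j = i

/-! ### Submatrices and orthogonal complements -/

/-- The upper `m × p` submatrix of an `n × p` matrix, `m ≤ n`. -/
def upperRows {n m p : ℕ} (h : m ≤ n) (M : Matrix (Fin n) (Fin p) ℂ) :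
    Matrix (Fin m) (Fin p) ℂ :=
  M.submatrix (Fin.castLE h) id

/-- The columns of `N` form a basis of the orthogonal complement (with respect to the standard
Hermitian inner product) of the range of `M`. -/
def IsOrthComplBasis {n p k : ℕ} (M : Matrix (Fin n) (Fin p) ℂ) (N : Matrix (Fin n) (Fin k) ℂ) :
    Prop :=
  LinearIndependent ℂ (fun j : Fin k => N.col j) ∧
    ∀ v : Fin n → ℂ, v ∈ Submodule.span ℂ (Set.range fun j : Fin k => N.col j) ↔
      ∀ u : Fin p → ℂ, star (M *ᵥ u) ⬝ᵥ v = 0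

end MatrixPencil

end

open MatrixPencil

open Matrix

noncomputable section

/-! Write the Kronecker form as diag(S, L), where S collects the regular and the right singular
blocks and L the left singular blocks, and let r = n - k. The number of rows of S plus the number of
columns of L is r. Away from the eigenvalues of R the pencil S has full row rank.

Multiply from the left by X = W* with r rows. For generic X a change of basis of the r rows turns X
P⁻¹ into [1 Y₁₂; 0 Y₂₂] with Y₁₂ L_F = 0 and Y₂₂ L_F = 1, where L = L_E - λ L_F. The product becomes
block triangular, with S and C - λ on the diagonal, C = Y₂₂ L_E, and a constant off-diagonal block.
Generically C has distinct eigenvalues outside the spectrum of R: this is the nonvanishing of a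
polynomial in X, and a Vandermonde choice of X shows that the polynomial is not zero. Surjectivity
of S at the eigenvalues of C solves a Sylvester equation that removes the off-diagonal block
(`strictEquiv_mul_of_isGoodProjector`). So left multiplication replaces the left singular blocks by
simple eigenvalues `cs` (`HasKroneckerForm.exists_polynomial_mul_left`). The same statement for the
transposed pencil lets Z replace the right singular blocks by simple eigenvalues `ds`, which avoid R
and `cs`. This gives the first claim, with `cs ++ ds` as the added spectrum.

For the second claim put M = A - μB (M = B at infinity). The rank of a pencil at μ is its normal
rank minus the number of blocks at μ. If μ belongs to R, no added block sits at μ, so W*MZ and M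
have equal rank, and so do W*M and MZ. Hence y*W*MZ = 0 forces y*W*M = 0, and W*MZx = 0 forces MZx =
0; both orthogonality relations follow. If μ is in `cs`, then M has rank r and a generic Z makes MZ
injective; the right relation would give MZx = 0. If μ is in `ds`, then W*M has full row rank; the
left relation would give y*W*M = 0. Both contradict that eigenvectors are nonzero.

Existence of the Kronecker form is proved by splitting off one block at a time: L_j from a
polynomial null vector of least degree, its transpose dually, and otherwise a Jordan block from a
longest chain. The complementary summand comes from a dual chain of functionals, supplied by the
solvability criterion for linear systems (`exists_dual_sequence`). -/

namespace MatrixPencil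

set_option linter.unusedSectionVars false

/-! ### Strict equivalence over arbitrary finite index types. -/

section StrictEquivalence

variable {ι κ ι' κ' ι'' κ'' ι₁ κ₁ ι₂ κ₂ : Type*}
  [Fintype ι] [Fintype κ] [Fintype ι'] [Fintype κ'] [Fintype ι''] [Fintype κ'']
  [Fintype ι₁] [Fintype κ₁] [Fintype ι₂] [Fintype κ₂]
  [DecidableEq ι] [DecidableEq κ] [DecidableEq ι'] [DecidableEq κ'] [DecidableEq ι'']
  [DecidableEq κ''] [DecidableEq ι₁] [DecidableEq κ₁] [DecidableEq ι₂] [DecidableEq κ₂]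

/-- Strict equivalence of the pencils `A - λ B` and `A' - λ B'`, for arbitrary index types. -/
def StrictEquiv (A B : Matrix ι κ ℂ) (A' B' : Matrix ι' κ' ℂ) : Prop :=
  ∃ (P : Matrix ι' ι ℂ) (P' : Matrix ι ι' ℂ) (Q : Matrix κ κ' ℂ) (Q' : Matrix κ' κ ℂ),
    P * P' = 1 ∧ P' * P = 1 ∧ Q * Q' = 1 ∧ Q' * Q = 1 ∧ P * A * Q = A' ∧ P * B * Q = B'

theorem StrictEquiv.refl (A B : Matrix ι κ ℂ) : StrictEquiv A B A B :=
  ⟨1, 1, 1, 1, by simp⟩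

theorem mul_cancel_outer {P : Matrix ι' ι ℂ} {P' : Matrix ι ι' ℂ} {Q : Matrix κ κ' ℂ}
    {Q' : Matrix κ' κ ℂ} (hP : P' * P = 1) (hQ : Q * Q' = 1) (A : Matrix ι κ ℂ) :
    P' * (P * A * Q) * Q' = A := by
  calc P' * (P * A * Q) * Q' = (P' * P) * A * (Q * Q') := by simp only [Matrix.mul_assoc]
    _ = A := by simp [hP, hQ]

theorem StrictEquiv.symm {A B : Matrix ι κ ℂ} {A' B' : Matrix ι' κ' ℂ}
    (h : StrictEquiv A B A' B') : StrictEquiv A' B' A B := by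
  obtain ⟨P, P', Q, Q', h1, h2, h3, h4, rfl, rfl⟩ := h
  exact ⟨P', P, Q', Q, h2, h1, h4, h3, mul_cancel_outer h2 h3 A, mul_cancel_outer h2 h3 B⟩

theorem mul_mul_mul_cancel_middle {P : Matrix ι' ι ℂ} {P' : Matrix ι ι' ℂ}
    {R : Matrix ι'' ι' ℂ} {R' : Matrix ι' ι'' ℂ} (h : P * P' = 1) (h' : R * R' = 1) :
    (R * P) * (P' * R') = 1 := by
  calc (R * P) * (P' * R') = R * (P * P') * R' := by simp only [Matrix.mul_assoc]
    _ = 1 := by simp [h, h']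

theorem StrictEquiv.trans {A B : Matrix ι κ ℂ} {A' B' : Matrix ι' κ' ℂ}
    {A'' B'' : Matrix ι'' κ'' ℂ} (h : StrictEquiv A B A' B') (h' : StrictEquiv A' B' A'' B'') :
    StrictEquiv A B A'' B'' := by
  obtain ⟨P, P', Q, Q', h1, h2, h3, h4, rfl, rfl⟩ := h
  obtain ⟨R, R', T, T', k1, k2, k3, k4, rfl, rfl⟩ := h'
  exact ⟨R * P, P' * R', Q * T, T' * Q', mul_mul_mul_cancel_middle h1 k1,
    mul_mul_mul_cancel_middle k2 h2, mul_mul_mul_cancel_middle k3 h3,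
    mul_mul_mul_cancel_middle h4 k4, by simp only [Matrix.mul_assoc],
    by simp only [Matrix.mul_assoc]⟩

theorem StrictEquiv.transpose {A B : Matrix ι κ ℂ} {A' B' : Matrix ι' κ' ℂ}
    (h : StrictEquiv A B A' B') : StrictEquiv Aᵀ Bᵀ A'ᵀ B'ᵀ := by
  obtain ⟨P, P', Q, Q', h1, h2, h3, h4, rfl, rfl⟩ := h
  refine ⟨Qᵀ, Q'ᵀ, Pᵀ, P'ᵀ, ?_, ?_, ?_, ?_, ?_, ?_⟩ <;>
    simp [← Matrix.transpose_mul, h1, h2, h3, h4, Matrix.mul_assoc]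

theorem StrictEquiv.submatrix (A B : Matrix ι κ ℂ) (e : ι' ≃ ι) (f : κ' ≃ κ) :
    StrictEquiv A B (A.submatrix e f) (B.submatrix e f) := by
  refine ⟨(1 : Matrix ι ι ℂ).submatrix e id, (1 : Matrix ι ι ℂ).submatrix id e,
    (1 : Matrix κ κ ℂ).submatrix id f, (1 : Matrix κ κ ℂ).submatrix f id, ?_, ?_, ?_, ?_, ?_, ?_⟩
  · rw [← Matrix.submatrix_mul _ _ _ _ _ Function.bijective_id]; simp
  · rw [Matrix.submatrix_mul_equiv]; simp
  · rw [Matrix.submatrix_mul_equiv]; simp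
  · rw [← Matrix.submatrix_mul _ _ _ _ _ Function.bijective_id]; simp
  · ext i j; simp [Matrix.mul_apply, Matrix.one_apply]
  · ext i j; simp [Matrix.mul_apply, Matrix.one_apply]

theorem StrictEquiv.fromBlocks {A₁ B₁ : Matrix ι κ ℂ} {A₁' B₁' : Matrix ι' κ' ℂ}
    {A₂ B₂ : Matrix ι₁ κ₁ ℂ} {A₂' B₂' : Matrix ι₂ κ₂ ℂ}
    (h : StrictEquiv A₁ B₁ A₁' B₁') (h' : StrictEquiv A₂ B₂ A₂' B₂') :
    StrictEquiv (fromBlocks A₁ 0 0 A₂) (fromBlocks B₁ 0 0 B₂)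
      (fromBlocks A₁' 0 0 A₂') (fromBlocks B₁' 0 0 B₂') := by
  obtain ⟨P, P', Q, Q', h1, h2, h3, h4, rfl, rfl⟩ := h
  obtain ⟨R, R', T, T', k1, k2, k3, k4, rfl, rfl⟩ := h'
  refine ⟨Matrix.fromBlocks P 0 0 R, Matrix.fromBlocks P' 0 0 R', Matrix.fromBlocks Q 0 0 T,
    Matrix.fromBlocks Q' 0 0 T', ?_, ?_, ?_, ?_, ?_, ?_⟩ <;>
    simp [Matrix.fromBlocks_multiply, h1, h2, h3, h4, k1, k2, k3, k4]

theorem StrictEquiv.card_eq {A B : Matrix ι κ ℂ} {A' B' : Matrix ι' κ' ℂ}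
    (h : StrictEquiv A B A' B') :
    Fintype.card ι = Fintype.card ι' ∧ Fintype.card κ = Fintype.card κ' := by
  obtain ⟨P, P', Q, Q', h1, h2, h3, h4, -, -⟩ := h
  exact ⟨(Matrix.square_of_invertible P P' h1 h2).symm, Matrix.square_of_invertible Q Q' h3 h4⟩

theorem rank_mul_mul_of_inverses {P : Matrix ι' ι ℂ} {P' : Matrix ι ι' ℂ} {Q : Matrix κ κ' ℂ}
    {Q' : Matrix κ' κ ℂ} (hP : P' * P = 1) (hQ : Q * Q' = 1) (A : Matrix ι κ ℂ) :
    (P * A * Q).rank = A.rank := by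
  apply le_antisymm
  · exact (Matrix.rank_mul_le_left _ _).trans (Matrix.rank_mul_le_right _ _)
  · conv_lhs => rw [← mul_cancel_outer hP hQ A]
    exact (Matrix.rank_mul_le_left _ _).trans (Matrix.rank_mul_le_right _ _)

end StrictEquivalence

/-! ### Block diagonal pencils indexed by multisets of blocks. -/

section Blocks

/-- The constant coefficient of the block diagonal pencil with blocks `b i`. -/
def blocksE {τ : Type*} [DecidableEq τ] (b : τ → KroneckerBlock) :
    Matrix (Σ i, Fin (b i).rows) (Σ i, Fin (b i).cols) ℂ :=
  Matrix.blockDiagonal' fun i => (b i).matE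

/-- The coefficient of `-λ` of the block diagonal pencil with blocks `b i`. -/
def blocksF {τ : Type*} [DecidableEq τ] (b : τ → KroneckerBlock) :
    Matrix (Σ i, Fin (b i).rows) (Σ i, Fin (b i).cols) ℂ :=
  Matrix.blockDiagonal' fun i => (b i).matF

theorem exists_equiv_of_map_univ_eq {τ τ' α : Type*} [Fintype τ] [Fintype τ'] (b : τ → α)
    (b' : τ' → α) (h : Finset.univ.val.map b = Finset.univ.val.map b') :
    ∃ σ : τ ≃ τ', ∀ i, b' (σ i) = b i := by
  classical
  have hc : ∀ x, Fintype.card {i // b i = x} = Fintype.card {i // b' i = x} := by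
    intro x
    have := congrArg (Multiset.count x) h
    rw [Multiset.count_map, Multiset.count_map] at this
    rw [Fintype.card_subtype, Fintype.card_subtype]
    simp only [Finset.card_def, Finset.filter_val]
    simpa [eq_comm] using this
  let g : ∀ x, {i // b i = x} ≃ {i // b' i = x} := fun x => Fintype.equivOfCardEq (hc x)
  refine ⟨(Equiv.sigmaFiberEquiv b).symm.trans
    ((Equiv.sigmaCongrRight g).trans (Equiv.sigmaFiberEquiv b')), fun i => ?_⟩
  exact (g (b i) ⟨i, rfl⟩).2

theorem blockDiagonal'_comp_equiv {τ τ' : Type*} [DecidableEq τ] [DecidableEq τ']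
    {m n : τ' → Type*} (M : ∀ i, Matrix (m i) (n i) ℂ) (σ : τ ≃ τ') :
    Matrix.blockDiagonal' (fun i => M (σ i)) =
      (Matrix.blockDiagonal' M).submatrix (Equiv.sigmaCongrLeft σ)
        (Equiv.sigmaCongrLeft σ) := by
  ext ⟨i, r⟩ ⟨j, c⟩
  by_cases h : i = j
  · subst h
    simp [Matrix.blockDiagonal'_apply_eq]
  · have h' : σ i ≠ σ j := fun h' => h (σ.injective h')
    simp [Matrix.blockDiagonal'_apply_ne, h, h']

theorem strictEquiv_blocks_of_map_eq {τ τ' : Type*} [Fintype τ] [Fintype τ'] [DecidableEq τ]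
    [DecidableEq τ'] (b : τ → KroneckerBlock) (b' : τ' → KroneckerBlock)
    (h : Finset.univ.val.map b = Finset.univ.val.map b') :
    StrictEquiv (blocksE b) (blocksF b) (blocksE b') (blocksF b') := by
  obtain ⟨σ, hσ⟩ := exists_equiv_of_map_univ_eq b b' h
  obtain rfl : (fun i => b' (σ i)) = b := funext hσ
  apply StrictEquiv.symm
  unfold blocksE blocksF
  rw [blockDiagonal'_comp_equiv (fun i => (b' i).matE) σ,
    blockDiagonal'_comp_equiv (fun i => (b' i).matF) σ]
  exact StrictEquiv.submatrix _ _ _ _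

variable {ι κ ι' κ' ι₁ κ₁ ι₂ κ₂ : Type*}
  [Fintype ι] [Fintype κ] [Fintype ι'] [Fintype κ']
  [Fintype ι₁] [Fintype κ₁] [Fintype ι₂] [Fintype κ₂]
  [DecidableEq ι] [DecidableEq κ] [DecidableEq ι'] [DecidableEq κ']
  [DecidableEq ι₁] [DecidableEq κ₁] [DecidableEq ι₂] [DecidableEq κ₂]

/-- The pencil `A - λ B` is strictly equivalent to the block diagonal pencil whose blocks form the
multiset `S`. -/
def HasBlocks (A B : Matrix ι κ ℂ) (S : Multiset KroneckerBlock) : Prop :=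
  ∃ l : List KroneckerBlock, (l : Multiset KroneckerBlock) = S ∧
    StrictEquiv A B (blocksE l.get) (blocksF l.get)

theorem univ_map_get {α : Type*} (l : List α) :
    (Finset.univ : Finset (Fin l.length)).val.map l.get = (l : Multiset α) := by
  rw [Fin.univ_val_map]
  simp

theorem hasBlocks_iff {τ : Type*} [Fintype τ] [DecidableEq τ] {A B : Matrix ι κ ℂ}
    {b : τ → KroneckerBlock} {S : Multiset KroneckerBlock} (hb : Finset.univ.val.map b = S) :
    HasBlocks A B S ↔ StrictEquiv A B (blocksE b) (blocksF b) := by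
  constructor
  · rintro ⟨l, hl, h⟩
    exact h.trans (strictEquiv_blocks_of_map_eq _ _ (by rw [univ_map_get, hl, hb]))
  · intro h
    obtain ⟨l, rfl⟩ := Quot.exists_rep S
    exact ⟨l, rfl, h.trans (strictEquiv_blocks_of_map_eq _ _ (by rw [univ_map_get, hb]; rfl))⟩

theorem HasBlocks.of_strictEquiv {A B : Matrix ι κ ℂ} {A' B' : Matrix ι' κ' ℂ}
    {S : Multiset KroneckerBlock} (h : StrictEquiv A B A' B') (h' : HasBlocks A' B' S) :
    HasBlocks A B S := by
  obtain ⟨l, hl, h'⟩ := h'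
  exact ⟨l, hl, h.trans h'⟩

theorem strictEquiv_blocks_sumElim {τ τ' : Type*} [Fintype τ] [Fintype τ'] [DecidableEq τ]
    [DecidableEq τ'] (b : τ → KroneckerBlock) (b' : τ' → KroneckerBlock) :
    StrictEquiv (fromBlocks (blocksE b) 0 0 (blocksE b')) (fromBlocks (blocksF b) 0 0 (blocksF b'))
      (blocksE (Sum.elim b b')) (blocksF (Sum.elim b b')) := by
  have key := StrictEquiv.submatrix (fromBlocks (blocksE b) 0 0 (blocksE b'))
    (fromBlocks (blocksF b) 0 0 (blocksF b'))
    (Equiv.sumSigmaDistrib fun i => Fin ((Sum.elim b b' i).rows))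
    (Equiv.sumSigmaDistrib fun i => Fin ((Sum.elim b b' i).cols))
  convert key using 1
  · ext ⟨i, r⟩ ⟨j, c⟩
    rcases i with i | i <;> rcases j with j | j <;>
      simp [blocksE, Matrix.blockDiagonal'_apply, Equiv.sumSigmaDistrib]
  · ext ⟨i, r⟩ ⟨j, c⟩
    rcases i with i | i <;> rcases j with j | j <;>
      simp [blocksF, Matrix.blockDiagonal'_apply, Equiv.sumSigmaDistrib]

theorem HasBlocks.fromBlocks {A B : Matrix ι κ ℂ} {A' B' : Matrix ι' κ' ℂ}
    {S S' : Multiset KroneckerBlock} (h : HasBlocks A B S) (h' : HasBlocks A' B' S') :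
    HasBlocks (fromBlocks A 0 0 A') (fromBlocks B 0 0 B') (S + S') := by
  obtain ⟨l, rfl, h⟩ := h
  obtain ⟨l', rfl, h'⟩ := h'
  rw [hasBlocks_iff (b := Sum.elim l.get l'.get)]
  · exact (h.fromBlocks h').trans (strictEquiv_blocks_sumElim _ _)
  · rw [← univ_map_get l, ← univ_map_get l']
    rw [← Finset.univ_disjSum_univ, Finset.val_disjSum, Multiset.disjSum, Multiset.map_add,
      Multiset.map_map, Multiset.map_map]
    rfl

theorem hasBlocks_singleton (b : KroneckerBlock) : HasBlocks b.matE b.matF {b} := by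
  rw [hasBlocks_iff (b := fun _ : Unit => b) (by simp)]
  have key := StrictEquiv.submatrix b.matE b.matF (Equiv.uniqueSigma (α := Unit) fun _ => Fin b.rows)
    (Equiv.uniqueSigma (α := Unit) fun _ => Fin b.cols)
  convert key using 1
  · ext ⟨i, r⟩ ⟨j, c⟩
    simp [blocksE, Matrix.blockDiagonal'_apply]
    rfl
  · ext ⟨i, r⟩ ⟨j, c⟩
    simp [blocksF, Matrix.blockDiagonal'_apply]
    rfl

theorem hasBlocks_blocks {τ : Type*} [Fintype τ] [DecidableEq τ] (b : τ → KroneckerBlock) :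
    HasBlocks (blocksE b) (blocksF b) (Finset.univ.val.map b) :=
  (hasBlocks_iff rfl).2 (StrictEquiv.refl _ _)

theorem hasBlocks_zero [IsEmpty ι] [IsEmpty κ] (A B : Matrix ι κ ℂ) : HasBlocks A B 0 := by
  refine (hasBlocks_iff (b := (Empty.elim : Empty → KroneckerBlock)) (by simp)).2 ?_
  exact ⟨0, 0, 0, 0, Subsingleton.elim _ _, Subsingleton.elim _ _, Subsingleton.elim _ _,
    Subsingleton.elim _ _, Subsingleton.elim _ _, Subsingleton.elim _ _⟩

/-- Mutually inverse matrices force equal cardinalities of the index types, so numberings of rows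
and columns exist, and changing them is a strict equivalence. The order of the blocks thus
disappears from the bookkeeping. -/
theorem hasKroneckerForm_iff {n m : ℕ} {A B : Matrix (Fin n) (Fin m) ℂ} {R : List RegularBlock}
    {rt lf : List ℕ} :
    HasKroneckerForm A B R rt lf ↔
      HasBlocks A B (kroneckerBlocks R rt lf : Multiset KroneckerBlock) := by
  rw [hasBlocks_iff (univ_map_get _)]
  constructor
  · rintro ⟨e, f, P, Q, hP, hQ, hA, hB⟩
    have hP' : IsUnit P.det := isUnit_iff_ne_zero.2 hP
    have hQ' : IsUnit Q.det := isUnit_iff_ne_zero.2 hQ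
    have h1 : StrictEquiv A B (P * A * Q) (P * B * Q) :=
      ⟨P, P⁻¹, Q, Q⁻¹, Matrix.mul_nonsing_inv _ hP', Matrix.nonsing_inv_mul _ hP',
        Matrix.mul_nonsing_inv _ hQ', Matrix.nonsing_inv_mul _ hQ', rfl, rfl⟩
    refine h1.trans ?_
    rw [hA, hB]
    exact (StrictEquiv.submatrix _ _ e f).symm
  · intro h
    obtain ⟨hc1, hc2⟩ := h.card_eq
    let e := Fintype.equivOfCardEq hc1
    let f := Fintype.equivOfCardEq hc2
    have h2 := h.trans (StrictEquiv.submatrix _ _ e f)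
    obtain ⟨P, P', Q, Q', h1, h2, h3, h4, h5, h6⟩ := h2
    refine ⟨e, f, P, Q, ?_, ?_, h5, h6⟩
    · intro h0
      have := congrArg Matrix.det h1
      simp [h0] at this
    · intro h0
      have := congrArg Matrix.det h3
      simp [h0] at this

end Blocks

/-! ### Splitting a direct summand off a pencil. -/

section Splitting

variable {ι κ p q : Type*} [Fintype ι] [Fintype κ] [Fintype p] [Fintype q]
  [DecidableEq ι] [DecidableEq κ] [DecidableEq p] [DecidableEq q]

/-- X Φ is a projection. The columns of X₂ are a basis of its kernel ker Φ, and Φ₂ takes the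
coordinates of v - X Φ v in that basis. -/
theorem exists_complement_of_mul_eq_one {Φ : Matrix q ι ℂ} {X : Matrix ι q ℂ} (h : Φ * X = 1) :
    ∃ (d : ℕ) (X₂ : Matrix ι (Fin d) ℂ) (Φ₂ : Matrix (Fin d) ι ℂ),
      d + Fintype.card q = Fintype.card ι ∧ Φ * X₂ = 0 ∧ Φ₂ * X = 0 ∧ Φ₂ * X₂ = 1 ∧
      X * Φ + X₂ * Φ₂ = 1 := by
  let φ := Matrix.toLin' Φ
  let χ := Matrix.toLin' X
  have hφχ : φ ∘ₗ χ = LinearMap.id := by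
    rw [← Matrix.toLin'_mul, h, Matrix.toLin'_one]
  have hφχ' : ∀ v, φ (χ v) = v := fun v => LinearMap.congr_fun hφχ v
  let K := LinearMap.ker φ
  let b := Module.finBasis ℂ K
  let g : (ι → ℂ) →ₗ[ℂ] K := LinearMap.codRestrict K (LinearMap.id - χ ∘ₗ φ)
    (fun v => by simp [K, hφχ'])
  have hg : ∀ v, (g v : ι → ℂ) = v - χ (φ v) := fun v => rfl
  let s : (Fin (Module.finrank ℂ K) → ℂ) →ₗ[ℂ] (ι → ℂ) := K.subtype ∘ₗ b.equivFun.symm.toLinearMap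
  let t : (ι → ℂ) →ₗ[ℂ] (Fin (Module.finrank ℂ K) → ℂ) := b.equivFun.toLinearMap ∘ₗ g
  have hΦ : Φ = LinearMap.toMatrix' φ := by simp [φ]
  have hX : X = LinearMap.toMatrix' χ := by simp [χ]
  refine ⟨Module.finrank ℂ K, LinearMap.toMatrix' s, LinearMap.toMatrix' t, ?_, ?_, ?_, ?_, ?_⟩
  · have h1 := LinearMap.finrank_range_add_finrank_ker φ
    have h2 : LinearMap.range φ = ⊤ := LinearMap.range_eq_top.2 fun v => ⟨χ v, hφχ' v⟩
    rw [h2, finrank_top, Module.finrank_pi, Module.finrank_pi] at h1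
    change Module.finrank ℂ (LinearMap.ker φ) + _ = _
    omega
  · rw [hΦ, ← LinearMap.toMatrix'_comp]
    have : φ ∘ₗ s = 0 :=
      LinearMap.ext fun v => LinearMap.mem_ker.1 (b.equivFun.symm v).2
    rw [this, map_zero]
  · rw [hX, ← LinearMap.toMatrix'_comp]
    have : t ∘ₗ χ = 0 := by
      have : g ∘ₗ χ = 0 := by
        refine LinearMap.ext fun v => Subtype.ext ?_
        simp [hg, hφχ']
      rw [LinearMap.comp_assoc, this, LinearMap.comp_zero]
    rw [this, map_zero]
  · rw [← LinearMap.toMatrix'_comp]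
    have : t ∘ₗ s = LinearMap.id := by
      refine LinearMap.ext fun v => ?_
      have h3 : g (s v) = b.equivFun.symm v := by
        refine Subtype.ext ?_
        have h4 : φ (s v) = 0 := LinearMap.mem_ker.1 (b.equivFun.symm v).2
        rw [hg, h4, map_zero, sub_zero]
        rfl
      change b.equivFun (g (s v)) = v
      rw [h3, LinearEquiv.apply_symm_apply]
    rw [this, LinearMap.toMatrix'_id]
  · rw [hX, hΦ, ← LinearMap.toMatrix'_comp, ← LinearMap.toMatrix'_comp, ← map_add]
    have : χ ∘ₗ φ + s ∘ₗ t = LinearMap.id := by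
      refine LinearMap.ext fun v => ?_
      have h3 : s (t v) = v - χ (φ v) := by
        change ((b.equivFun.symm (b.equivFun (g v)) : K) : ι → ℂ) = _
        rw [LinearEquiv.symm_apply_apply, hg]
      simp [h3]
    rw [this, LinearMap.toMatrix'_id]

/-- The pair (X, Y) embeds E - λF as a subpencil and (Φ, Ψ) retracts onto it. In the bases completed
by ker Φ and ker Ψ, the off-diagonal blocks vanish: Ψ A X₂ = E Φ X₂ = 0 and Ψ₂ A X = Ψ₂ Y E = 0. -/
theorem exists_strictEquiv_fromBlocks_of_mul_eq_one {A B : Matrix ι κ ℂ} {X : Matrix κ q ℂ}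
    {Y : Matrix ι p ℂ} {Φ : Matrix q κ ℂ} {Ψ : Matrix p ι ℂ} {E F : Matrix p q ℂ}
    (hAX : A * X = Y * E) (hBX : B * X = Y * F) (hA : Ψ * A = E * Φ) (hB : Ψ * B = F * Φ)
    (hΦ : Φ * X = 1) (hΨ : Ψ * Y = 1) :
    ∃ (n m : ℕ) (A' B' : Matrix (Fin n) (Fin m) ℂ), n + Fintype.card p = Fintype.card ι ∧
      m + Fintype.card q = Fintype.card κ ∧
      StrictEquiv A B (fromBlocks E 0 0 A') (fromBlocks F 0 0 B') := by
  obtain ⟨m, X₂, Φ₂, hm, h1, h2, h3, h4⟩ := exists_complement_of_mul_eq_one hΦ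
  obtain ⟨n, Y₂, Ψ₂, hn, k1, k2, k3, k4⟩ := exists_complement_of_mul_eq_one hΨ
  refine ⟨n, m, Ψ₂ * A * X₂, Ψ₂ * B * X₂, hn, hm, fromRows Ψ Ψ₂, fromCols Y Y₂, fromCols X X₂,
    fromRows Φ Φ₂, ?_, ?_, ?_, ?_, ?_, ?_⟩
  · rw [fromRows_mul_fromCols, hΨ, k1, k2, k3, fromBlocks_one]
  · rw [fromCols_mul_fromRows, k4]
  · rw [fromCols_mul_fromRows, h4]
  · rw [fromRows_mul_fromCols, hΦ, h1, h2, h3, fromBlocks_one]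
  · rw [fromRows_mul, fromRows_mul_fromCols, hA, Matrix.mul_assoc E, Matrix.mul_assoc E, hΦ, h1,
      Matrix.mul_assoc Ψ₂ A X, hAX, ← Matrix.mul_assoc, k2]
    simp
  · rw [fromRows_mul, fromRows_mul_fromCols, hB, Matrix.mul_assoc F, Matrix.mul_assoc F, hΦ, h1,
      Matrix.mul_assoc Ψ₂ B X, hBX, ← Matrix.mul_assoc, k2]
    simp

/-- The intertwining relations give (Ψ Y) G = G (Φ X) for G = E, F, so X and Y can be normalized by
(Φ X)⁻¹ and (Ψ Y)⁻¹ without disturbing them. -/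
theorem exists_strictEquiv_fromBlocks {A B : Matrix ι κ ℂ} {X : Matrix κ q ℂ}
    {Y : Matrix ι p ℂ} {Φ : Matrix q κ ℂ} {Ψ : Matrix p ι ℂ} {E F : Matrix p q ℂ}
    (hAX : A * X = Y * E) (hBX : B * X = Y * F) (hA : Ψ * A = E * Φ) (hB : Ψ * B = F * Φ)
    (hΦ : IsUnit (Φ * X).det) (hΨ : IsUnit (Ψ * Y).det) :
    ∃ (n m : ℕ) (A' B' : Matrix (Fin n) (Fin m) ℂ), n + Fintype.card p = Fintype.card ι ∧
      m + Fintype.card q = Fintype.card κ ∧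
      StrictEquiv A B (fromBlocks E 0 0 A') (fromBlocks F 0 0 B') := by
  have key : ∀ {C : Matrix ι κ ℂ} {G : Matrix p q ℂ}, C * X = Y * G → Ψ * C = G * Φ →
      C * (X * (Φ * X)⁻¹) = (Y * (Ψ * Y)⁻¹) * G := by
    intro C G h1 h2
    have h3 : (Ψ * Y) * G = G * (Φ * X) := by
      rw [Matrix.mul_assoc, ← h1, ← Matrix.mul_assoc, h2, Matrix.mul_assoc]
    have h4 : G * (Φ * X)⁻¹ = (Ψ * Y)⁻¹ * G := by
      calc G * (Φ * X)⁻¹ = (Ψ * Y)⁻¹ * ((Ψ * Y) * G) * (Φ * X)⁻¹ := by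
            rw [← Matrix.mul_assoc (Ψ * Y)⁻¹, Matrix.nonsing_inv_mul _ hΨ, Matrix.one_mul]
        _ = (Ψ * Y)⁻¹ * G := by
            rw [h3, Matrix.mul_assoc, Matrix.mul_assoc, Matrix.mul_nonsing_inv _ hΦ,
              Matrix.mul_one]
    rw [← Matrix.mul_assoc, h1, Matrix.mul_assoc, h4, Matrix.mul_assoc]
  refine exists_strictEquiv_fromBlocks_of_mul_eq_one (key hAX hA) (key hBX hB) hA hB ?_ ?_
  · rw [← Matrix.mul_assoc, Matrix.mul_nonsing_inv _ hΦ]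
  · rw [← Matrix.mul_assoc, Matrix.mul_nonsing_inv _ hΨ]

end Splitting

/-! ### Chains of vectors and dual chains of functionals. -/

section Chains

variable {n m : ℕ}

/-- Solvability criterion for the d linear equations of a chain that starts at f. If there is no
solution in S, a functional vanishes on all attainable right-hand sides but not on f. Its components
are the ψ i, and vanishing on the images of one-entry sequences is the dual chain relation. -/
theorem exists_dual_sequence (A B : Matrix (Fin n) (Fin m) ℂ) (f : Fin n → ℂ) (d : ℕ)
    (S : Submodule ℂ (ℕ → Fin m → ℂ))
    (h : ¬ ∃ v ∈ S, (0 < d → A *ᵥ v 0 = f) ∧ ∀ i, i + 1 < d → A *ᵥ v (i + 1) = B *ᵥ v i) :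
    ∃ ψ : ℕ → Fin n → ℂ, ψ 0 ⬝ᵥ f = 1 ∧ (∀ i, d ≤ i → ψ i = 0) ∧
      ∀ i v, Pi.single i v ∈ S → ψ i ⬝ᵥ A *ᵥ v = ψ (i + 1) ⬝ᵥ B *ᵥ v := by
  -- Attainable right-hand sides. Entries from index d on are unconstrained, which later forces ψ i
  -- = 0 there.
  let U : Submodule ℂ (ℕ → Fin n → ℂ) :=
    { carrier := {w | ∃ v ∈ S, (0 < d → w 0 = A *ᵥ v 0) ∧
        ∀ i, i + 1 < d → w (i + 1) = A *ᵥ v (i + 1) - B *ᵥ v i}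
      zero_mem' := ⟨0, S.zero_mem, by simp, by simp⟩
      add_mem' := by
        rintro w w' ⟨v, hv, h1, h2⟩ ⟨v', hv', h1', h2'⟩
        refine ⟨v + v', S.add_mem hv hv', fun h0 => ?_, fun i hi => ?_⟩
        · simp [h1 h0, h1' h0, Matrix.mulVec_add]
        · simp only [Pi.add_apply, h2 i hi, h2' i hi, Matrix.mulVec_add]
          abel
      smul_mem' := by
        rintro c w ⟨v, hv, h1, h2⟩
        refine ⟨c • v, S.smul_mem c hv, fun h0 => ?_, fun i hi => ?_⟩
        · simp [h1 h0, Matrix.mulVec_smul]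
        · simp only [Pi.smul_apply, h2 i hi, Matrix.mulVec_smul, smul_sub] }
  have hf : (Pi.single 0 f : ℕ → Fin n → ℂ) ∉ U := by
    rintro ⟨v, hv, h1, h2⟩
    refine h ⟨v, hv, fun h0 => ?_, fun i hi => ?_⟩
    · simpa using (h1 h0).symm
    · have := h2 i hi
      simp only [Pi.single_eq_of_ne (Nat.succ_ne_zero i)] at this
      exact (sub_eq_zero.1 this.symm)
  obtain ⟨Θ, hΘf, hΘU⟩ := Submodule.exists_le_ker_of_notMem hf
  have hΘ0 : ∀ w ∈ U, Θ w = 0 := fun w hw => LinearMap.mem_ker.1 (hΘU hw)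
  let c := (Θ (Pi.single 0 f))⁻¹
  let ψ : ℕ → Fin n → ℂ := fun i j => c * Θ (Pi.single i (Pi.single j 1))
  have hψ : ∀ i w, ψ i ⬝ᵥ w = c * Θ (Pi.single i w) := by
    intro i w
    have h1 : (Pi.single i w : ℕ → Fin n → ℂ) =
        ∑ j, w j • (Pi.single i (Pi.single j (1 : ℂ)) : ℕ → Fin n → ℂ) := by
      have h2 : w = ∑ j, w j • (Pi.single j (1 : ℂ) : Fin n → ℂ) := pi_eq_sum_univ' w
      conv_lhs => rw [h2]
      change LinearMap.single ℂ (fun _ : ℕ => Fin n → ℂ) i _ = _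
      rw [map_sum]
      simp only [map_smul]
      rfl
    rw [h1, map_sum, Finset.mul_sum]
    refine Finset.sum_congr rfl fun j _ => ?_
    simp only [ψ, map_smul, smul_eq_mul]
    ring
  refine ⟨ψ, ?_, ?_, ?_⟩
  · rw [hψ]
    exact inv_mul_cancel₀ hΘf
  · intro i hi
    funext j
    have : Θ (Pi.single i (Pi.single j 1)) = 0 := by
      refine hΘ0 _ ⟨0, S.zero_mem, fun h0 => ?_, fun l hl => ?_⟩
      · rw [Pi.single_eq_of_ne (by omega)]; simp
      · rw [Pi.single_eq_of_ne (by omega)]; simp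
    simp [ψ, this]
  · intro i v hv
    rw [hψ, hψ]
    have : Θ (Pi.single i (A *ᵥ v) - Pi.single (i + 1) (B *ᵥ v)) = 0 := by
      refine hΘ0 _ ⟨_, hv, fun _ => ?_, fun l _ => ?_⟩
      · rcases Nat.eq_zero_or_pos i with rfl | hi
        · simp
        · simp [Pi.single_eq_of_ne hi.ne]
      · by_cases h1 : l + 1 = i
        · subst h1; simp
        · by_cases h2 : l = i
          · subst h2; simp
          · have h3 : l + 1 ≠ i + 1 := by omega
            simp [h1, h2]
    rw [map_sub, sub_eq_zero] at this
    rw [this]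

/-- Moving one step down the dual chain and one step down the chain leaves the pairing unchanged, so
the pairing matrix is upper triangular Toeplitz. -/
theorem dual_sequence_dotProduct {A B : Matrix (Fin n) (Fin m) ℂ} {x : ℕ → Fin m → ℂ}
    {ψ : ℕ → Fin n → ℂ} {d : ℕ} (hx0 : A *ᵥ x 0 = 0)
    (hx : ∀ i, i + 1 < d → A *ᵥ x (i + 1) = B *ᵥ x i)
    (hψ : ∀ i v, i + 1 < d → ψ i ⬝ᵥ A *ᵥ v = ψ (i + 1) ⬝ᵥ B *ᵥ v) (i l : ℕ) (hi : i < d)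
    (hl : l < d) :
    ψ i ⬝ᵥ B *ᵥ x l = if i ≤ l then ψ 0 ⬝ᵥ B *ᵥ x (l - i) else 0 := by
  induction i generalizing l with
  | zero => simp
  | succ i ih =>
    rw [← hψ i _ hi]
    cases l with
    | zero => simp [hx0]
    | succ l =>
      rw [hx l hl, ih l (by omega) (by omega)]
      simp

/-- A sequence of vectors that are, when almost all of them vanish, the coefficients of a
polynomial solution of `(A - λ B) x(λ) = 0`. -/
def IsNullChain (A B : Matrix (Fin n) (Fin m) ℂ) (x : ℕ → Fin m → ℂ) : Prop :=
  A *ᵥ x 0 = 0 ∧ ∀ i, A *ᵥ x (i + 1) = B *ᵥ x i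

/-- `(A - λ B) x(λ) = 0` has a nonzero polynomial solution of degree at most `d`. -/
def HasNullChain (A B : Matrix (Fin n) (Fin m) ℂ) (d : ℕ) : Prop :=
  ∃ x, IsNullChain A B x ∧ x ≠ 0 ∧ ∀ i, d < i → x i = 0

end Chains

/-! ### Splitting off a right singular block. -/

section Singular

variable {n m : ℕ}

/-- The constant coefficient of `L_j(λ)`. -/
def rightE (j : ℕ) : Matrix (Fin j) (Fin (j + 1)) ℂ :=
  Matrix.of fun i l => if l = i.succ then 1 else 0

/-- The coefficient of `-λ` of `L_j(λ)`. -/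
def rightF (j : ℕ) : Matrix (Fin j) (Fin (j + 1)) ℂ :=
  Matrix.of fun i l => if l = i.castSucc then 1 else 0

theorem mul_rightE_zero {ι : Type*} {j : ℕ} (Y : Matrix ι (Fin j) ℂ) (a : ι) :
    (Y * rightE j) a 0 = 0 := by
  rw [Matrix.mul_apply]
  exact Finset.sum_eq_zero fun i _ => by simp [rightE, (Fin.succ_ne_zero i).symm]

theorem mul_rightE_succ {ι : Type*} {j : ℕ} (Y : Matrix ι (Fin j) ℂ) (a : ι) (i : Fin j) :
    (Y * rightE j) a i.succ = Y a i := by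
  simp [Matrix.mul_apply, rightE, Fin.succ_inj]

theorem mul_rightF_last {ι : Type*} {j : ℕ} (Y : Matrix ι (Fin j) ℂ) (a : ι) :
    (Y * rightF j) a (Fin.last j) = 0 := by
  rw [Matrix.mul_apply]
  exact Finset.sum_eq_zero fun i _ => by simp [rightF, (Fin.castSucc_lt_last i).ne']

theorem mul_rightF_castSucc {ι : Type*} {j : ℕ} (Y : Matrix ι (Fin j) ℂ) (a : ι)
    (i : Fin j) : (Y * rightF j) a i.castSucc = Y a i := by
  simp [Matrix.mul_apply, rightF]

theorem rightE_mul {κ : Type*} {j : ℕ} (Φ : Matrix (Fin (j + 1)) κ ℂ) (i : Fin j) (a : κ) :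
    (rightE j * Φ) i a = Φ i.succ a := by
  simp [Matrix.mul_apply, rightE]

theorem rightF_mul {κ : Type*} {j : ℕ} (Φ : Matrix (Fin (j + 1)) κ ℂ) (i : Fin j) (a : κ) :
    (rightF j * Φ) i a = Φ i.castSucc a := by
  simp [Matrix.mul_apply, rightF]

/-- A polynomial null vector of least degree d + 1 yields functionals dual to its coefficients: an
obstruction to them would be a null vector of degree at most d. -/
theorem exists_dual_sequence_of_minimal {A B : Matrix (Fin n) (Fin m) ℂ} {d : ℕ}
    {x : ℕ → Fin m → ℂ} (hx : IsNullChain A B x) (hxd : x (d + 1) ≠ 0)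
    (hxz : ∀ i, d + 1 < i → x i = 0) (hmin : ¬ HasNullChain A B d) :
    ∃ ψ : ℕ → Fin n → ℂ, ψ 0 ⬝ᵥ B *ᵥ x 0 = 1 ∧
      ∀ i v, i + 1 < d + 1 → ψ i ⬝ᵥ A *ᵥ v = ψ (i + 1) ⬝ᵥ B *ᵥ v := by
  let S : Submodule ℂ (ℕ → Fin m → ℂ) :=
    { carrier := {v | ∀ i, d ≤ i → v i = 0}
      zero_mem' := fun _ _ => rfl
      add_mem' := fun h h' i hi => by simp [h i hi, h' i hi]
      smul_mem' := fun c v h i hi => by simp [h i hi] }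
  obtain ⟨ψ, h1, -, h3⟩ := exists_dual_sequence A B (B *ᵥ x 0) (d + 1) S (by
    rintro ⟨v, hv, h0, h⟩
    have hv' : ∀ i, d ≤ i → v i = 0 := hv
    -- Subtracting the chain shifted by one cancels B x₀. The entry at d is -x (d + 1), nonzero
    -- because v vanishes from d on.
    refine hmin ⟨fun i => v i - x (i + 1), ⟨?_, fun i => ?_⟩, fun h0 => ?_, fun i hi => ?_⟩
    · simp only [Matrix.mulVec_sub, h0 (Nat.succ_pos d), hx.2 0, sub_self]
    · have : A *ᵥ v (i + 1) = B *ᵥ v i := by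
        by_cases hi : i + 1 < d + 1
        · exact h i hi
        · rw [hv' i (by omega), hv' (i + 1) (by omega)]; simp
      simp only [Matrix.mulVec_sub, hx.2 (i + 1), this]
    · have := congrFun h0 d
      simp only [hv' d le_rfl, zero_sub, Pi.zero_apply, neg_eq_zero] at this
      exact hxd this
    · simp only [hv' i hi.le, hxz (i + 1) (by omega), sub_self])
  refine ⟨ψ, h1, fun i v hi => h3 i v fun j hj => ?_⟩
  rw [Pi.single_eq_of_ne (by omega)]

/-- The Toeplitz matrix is the identity. A superdiagonal value equals some ψ i ⬝ B x_d = ψ i ⬝ A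
x_{d+1} = ψ (i + 1) ⬝ B x_{d+1}, and B x_{d+1} = A x_{d+2} = 0. -/
theorem dual_sequence_eq_ite {A B : Matrix (Fin n) (Fin m) ℂ} {d : ℕ}
    {x : ℕ → Fin m → ℂ} (hx : IsNullChain A B x) (hxz : x (d + 2) = 0) {ψ : ℕ → Fin n → ℂ}
    (h0 : ψ 0 ⬝ᵥ B *ᵥ x 0 = 1)
    (hψ : ∀ i v, i + 1 < d + 1 → ψ i ⬝ᵥ A *ᵥ v = ψ (i + 1) ⬝ᵥ B *ᵥ v) (i l : ℕ)
    (hi : i < d + 1) (hl : l < d + 2) :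
    ψ i ⬝ᵥ B *ᵥ x l = if i = l then 1 else 0 := by
  have hlast : B *ᵥ x (d + 1) = 0 := by rw [← hx.2 (d + 1), hxz, Matrix.mulVec_zero]
  have h := dual_sequence_dotProduct hx.1 (fun i _ => hx.2 i) hψ
  have hz : ∀ j, 0 < j → j < d + 1 → ψ 0 ⬝ᵥ B *ᵥ x j = 0 := by
    intro j hj hjd
    have h1 := h (d - j) d (by omega) (by omega)
    rw [if_pos (by omega), show d - (d - j) = j by omega, ← hx.2 d, hψ _ _ (by omega), hlast,
      dotProduct_zero] at h1
    exact h1.symm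
  by_cases hl' : l = d + 1
  · subst hl'
    rw [hlast, dotProduct_zero, if_neg (by omega)]
  · rw [h i l hi (by omega)]
    rcases lt_trichotomy i l with h2 | rfl | h2
    · rw [if_pos h2.le, if_neg h2.ne, hz _ (by omega) (by omega)]
    · simp [h0]
    · rw [if_neg (by omega), if_neg (by omega)]

theorem exists_split_right_of_nullChain_zero {A B : Matrix (Fin n) (Fin m) ℂ}
    (h : HasNullChain A B 0) :
    ∃ (n' m' : ℕ) (A' B' : Matrix (Fin n') (Fin m') ℂ), n' = n ∧ m' + 1 = m ∧
      StrictEquiv A B (fromBlocks (rightE 0) 0 0 A') (fromBlocks (rightF 0) 0 0 B') := by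
  obtain ⟨x, hx, hx0, hxz⟩ := h
  have hx1 : x 0 ≠ 0 := by
    intro h
    apply hx0
    funext i
    rcases Nat.eq_zero_or_pos i with rfl | hi
    · exact h
    · exact hxz i hi
  obtain ⟨a, ha⟩ := Function.ne_iff.1 hx1
  have hA : A *ᵥ x 0 = 0 := hx.1
  have hB : B *ᵥ x 0 = 0 := by rw [← hx.2 0, hxz 1 one_pos, Matrix.mulVec_zero]
  obtain ⟨n', m', A', B', hn, hm, h⟩ := exists_strictEquiv_fromBlocks
    (A := A) (B := B) (X := Matrix.of fun c (_ : Fin 1) => x 0 c)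
    (Y := (0 : Matrix (Fin n) (Fin 0) ℂ))
    (Φ := Matrix.of fun (_ : Fin 1) c => if c = a then 1 else 0) (Ψ := 0) (E := rightE 0)
    (F := rightF 0) (by ext i j; exact (congrFun hA i).trans (by simp))
    (by ext i j; exact (congrFun hB i).trans (by simp))
    (Subsingleton.elim _ _) (Subsingleton.elim _ _)
    (by
      rw [isUnit_iff_ne_zero, Matrix.det_unique]
      simpa [Matrix.mul_apply] using ha)
    (by simp)
  exact ⟨n', m', A', B', by simpa using hn, by simpa using hm, h⟩

theorem exists_split_right_of_minimal {A B : Matrix (Fin n) (Fin m) ℂ} {d : ℕ}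
    (h : HasNullChain A B (d + 1)) (hmin : ¬ HasNullChain A B d) :
    ∃ (n' m' : ℕ) (A' B' : Matrix (Fin n') (Fin m') ℂ), n' + (d + 1) = n ∧ m' + (d + 2) = m ∧
      StrictEquiv A B (fromBlocks (rightE (d + 1)) 0 0 A')
        (fromBlocks (rightF (d + 1)) 0 0 B') := by
  obtain ⟨x, hx, hx0, hxz⟩ := h
  have hxd : x (d + 1) ≠ 0 := fun h => hmin ⟨x, hx, hx0, fun i hi => by
    rcases Nat.lt_or_ge (d + 1) i with h' | h'
    · exact hxz i h'
    · rwa [show i = d + 1 by omega]⟩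
  obtain ⟨ψ, h0, hψ⟩ := exists_dual_sequence_of_minimal hx hxd hxz hmin
  have hδ := dual_sequence_eq_ite hx (hxz (d + 2) (by omega)) h0 hψ
  -- L_{d+1} has one more column than rows: ψ 0, …, ψ d give the rows ψ i B, and ψ d A supplies the
  -- last one.
  let φ : ℕ → Fin m → ℂ := fun i => if i < d + 1 then ψ i ᵥ* B else ψ (i - 1) ᵥ* A
  have hφ : ∀ i, i < d + 2 → ∀ l, l < d + 2 → φ i ⬝ᵥ x l = if i = l then 1 else 0 := by
    intro i hi l hl
    by_cases h : i < d + 1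
    · simp only [φ, if_pos h, ← Matrix.dotProduct_mulVec]
      exact hδ i l h hl
    · obtain rfl : i = d + 1 := by omega
      simp only [φ, if_neg h, ← Matrix.dotProduct_mulVec, Nat.add_sub_cancel]
      rcases l with _ | l
      · simp [hx.1]
      · rw [hx.2 l, hδ d l (by omega) (by omega)]
        simp
  have hψA : ∀ i, i < d + 1 → ψ i ᵥ* A = φ (i + 1) := by
    intro i hi
    by_cases h : i + 1 < d + 1
    · simp only [φ, if_pos h]
      refine dotProduct_eq _ _ fun v => ?_
      rw [← Matrix.dotProduct_mulVec, ← Matrix.dotProduct_mulVec, hψ i v h]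
    · simp only [φ, if_neg h, Nat.add_sub_cancel]
  have hψB : ∀ i, i < d + 1 → ψ i ᵥ* B = φ i := fun i hi => by simp only [φ, if_pos hi]
  obtain ⟨n', m', A', B', hn, hm, h⟩ := exists_strictEquiv_fromBlocks
    (A := A) (B := B) (X := Matrix.of fun c (l : Fin (d + 2)) => x l c)
    (Y := Matrix.of fun c (l : Fin (d + 1)) => (B *ᵥ x l) c)
    (Φ := Matrix.of fun (i : Fin (d + 2)) c => φ i c)
    (Ψ := Matrix.of fun (i : Fin (d + 1)) c => ψ i c) (E := rightE (d + 1))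
    (F := rightF (d + 1)) (by
      ext a l
      refine Fin.cases ?_ (fun l => ?_) l
      · rw [mul_rightE_zero]
        exact congrFun hx.1 a
      · rw [mul_rightE_succ]
        exact congrFun (hx.2 l) a)
    (by
      ext a l
      refine Fin.lastCases ?_ (fun l => ?_) l
      · rw [mul_rightF_last]
        have := congrFun (hx.2 (d + 1)) a
        rw [hxz _ (Nat.lt_succ_self _), Matrix.mulVec_zero] at this
        exact this.symm
      · rw [mul_rightF_castSucc]
        rfl)
    (by
      ext i a
      rw [rightE_mul]
      exact congrFun (hψA i i.2) a)
    (by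
      ext i a
      rw [rightF_mul]
      exact congrFun (hψB i i.2) a)
    (by
      convert isUnit_one
      rw [← Matrix.det_one (n := Fin (d + 2))]
      congr 1
      ext i l
      exact (hφ i i.2 l l.2).trans (by simp [Matrix.one_apply, Fin.ext_iff]))
    (by
      convert isUnit_one
      rw [← Matrix.det_one (n := Fin (d + 1))]
      congr 1
      ext i l
      exact (hδ i l i.2 (by omega)).trans (by simp [Matrix.one_apply, Fin.ext_iff]))
  exact ⟨n', m', A', B', by simpa using hn, by simpa using hm, h⟩

theorem exists_split_right {A B : Matrix (Fin n) (Fin m) ℂ} (h : ∃ d, HasNullChain A B d) :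
    ∃ (j n' m' : ℕ) (A' B' : Matrix (Fin n') (Fin m') ℂ), n' + j = n ∧ m' + (j + 1) = m ∧
      StrictEquiv A B (fromBlocks (rightE j) 0 0 A') (fromBlocks (rightF j) 0 0 B') := by
  classical
  have h1 := Nat.find_spec h
  have h2 : ∀ d, d < Nat.find h → ¬ HasNullChain A B d := fun d => Nat.find_min h
  rcases hd : Nat.find h with _ | d
  · rw [hd] at h1
    obtain ⟨n', m', A', B', hn, hm, h⟩ := exists_split_right_of_nullChain_zero h1
    exact ⟨0, n', m', A', B', hn, hm, h⟩
  · rw [hd] at h1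
    exact ⟨d + 1, exists_split_right_of_minimal h1 (h2 d (by omega))⟩

end Singular

/-! ### Splitting off a Jordan block, and when polynomial null vectors exist. -/

section Regular

variable {n m : ℕ}

/-- A chain of m + 1 vectors in an m-dimensional space is linearly dependent. Applying the
dependency to all downward shifts of the chain gives a new chain that reaches zero, which is a
polynomial null vector. -/
theorem exists_nullChain_of_long_chain {A B : Matrix (Fin n) (Fin m) ℂ} {x : ℕ → Fin m → ℂ}
    (hx0 : x 0 ≠ 0) (hx : A *ᵥ x 0 = 0) (hx' : ∀ i, i + 1 < m + 1 → A *ᵥ x (i + 1) = B *ᵥ x i) :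
    ∃ d, HasNullChain A B d := by
  classical
  have hdep : ¬ LinearIndependent ℂ (fun i : Fin (m + 1) => x i) := fun h => by
    have := h.fintype_card_le_finrank
    simp at this
  obtain ⟨g, hg, i₀, hi₀⟩ := Fintype.not_linearIndependent_iff.1 hdep
  let c : ℕ → ℂ := fun i => if h : i < m + 1 then g ⟨i, h⟩ else 0
  have hsum : ∑ l ∈ Finset.range (m + 1), c l • x l = 0 := by
    rw [Finset.sum_range, ← hg]
    exact Finset.sum_congr rfl fun i _ => by simp only [c, dif_pos i.2, Fin.eta]
  have hc₀ : c i₀ ≠ 0 := by simpa only [c, dif_pos i₀.2, Fin.eta] using hi₀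
  let s := Nat.findGreatest (fun i => c i ≠ 0) m
  have hcs : c s ≠ 0 := Nat.findGreatest_spec (P := fun i => c i ≠ 0)
    (Nat.lt_succ_iff.1 i₀.2) hc₀
  have hsm : s ≤ m := Nat.findGreatest_le m
  have hcz : ∀ l, s < l → l ≤ m → c l = 0 := fun l h1 h2 => by
    simpa using Nat.findGreatest_is_greatest (P := fun i => c i ≠ 0) h1 h2
  let z : ℤ → Fin m → ℂ := fun j => if j < 0 then 0 else x j.toNat
  have hz : ∀ j : ℤ, j < m → A *ᵥ z (j + 1) = B *ᵥ z j := by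
    intro j hj
    rcases lt_trichotomy (j + 1) 0 with h | h | h
    · simp [z, h, show j < 0 by omega]
    · simp [z, h, hx, show j < 0 by omega]
    · obtain ⟨k, rfl⟩ := Int.eq_ofNat_of_zero_le (show 0 ≤ j by omega)
      have h1 : ¬ ((k : ℤ) + 1 < 0) := by omega
      have h2 : ¬ ((k : ℤ) < 0) := by omega
      have h3 : ((k : ℤ) + 1).toNat = k + 1 := by omega
      simp only [z, if_neg h1, if_neg h2, h3, Int.toNat_natCast]
      exact hx' k (by omega)
  -- With s the last index of a nonzero coefficient and x extended by 0 to negative indices, w s is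
  -- the dependency itself and w 0 = c s • x 0 ≠ 0. Cutting off at s keeps the chain relations.
  let w : ℕ → Fin m → ℂ := fun i => ∑ l ∈ Finset.range (m + 1), c l • z (l + i - s)
  have hw : ∀ i, i + 1 ≤ s → A *ᵥ w (i + 1) = B *ᵥ w i := by
    intro i hi
    simp only [w, Matrix.mulVec_sum, Matrix.mulVec_smul]
    refine Finset.sum_congr rfl fun l hl => ?_
    have hl' := Finset.mem_range.1 hl
    by_cases hls : s < l
    · rw [hcz l hls (by omega)]; simp
    · rw [show ((l : ℤ) + (i + 1 : ℕ) - s) = (l + i - s) + 1 by push_cast; ring, hz _ (by omega)]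
  have hws : w s = 0 := by
    rw [← hsum]
    exact Finset.sum_congr rfl fun l _ => by simp [z]
  have hw0 : w 0 = c s • x 0 := by
    refine (Finset.sum_eq_single s (fun l hl hls => ?_) fun h => ?_).trans ?_
    · have hl' := Finset.mem_range.1 hl
      rcases lt_or_gt_of_ne hls with h | h
      · rw [show z ((l : ℤ) + (0 : ℕ) - s) = 0 from if_pos (by push_cast; omega), smul_zero]
      · rw [hcz l h (by omega), zero_smul]
    · exact absurd (Finset.mem_range.2 (by omega)) h
    · simp [z]
  have hw0' : w 0 ≠ 0 := by rw [hw0]; exact smul_ne_zero hcs hx0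
  have hs : 0 < s := Nat.pos_of_ne_zero fun h => hw0' (by rw [← h]; exact hws)
  refine ⟨s, fun i => if i < s then w i else 0, ⟨?_, fun i => ?_⟩, fun h => ?_, fun i hi => ?_⟩
  · simp only [if_pos hs, hw0, Matrix.mulVec_smul, hx, smul_zero]
  · rcases lt_trichotomy (i + 1) s with h | h | h
    · simp only [if_pos h, if_pos (show i < s by omega), hw i h.le]
    · have h1 := hw i h.le
      rw [h, hws, Matrix.mulVec_zero] at h1
      simp only [h, lt_irrefl, if_false, if_pos (show i < s by omega), Matrix.mulVec_zero, h1]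
    · simp only [if_neg (show ¬ i + 1 < s by omega), if_neg (show ¬ i < s by omega),
        Matrix.mulVec_zero]
  · have := congrFun h 0
    simp only [if_pos hs] at this
    exact hw0' this
  · simp only [if_neg (show ¬ i < s by omega)]

theorem exists_maximal_chain {A B : Matrix (Fin n) (Fin m) ℂ} (hno : ¬ ∃ d, HasNullChain A B d)
    {x₀ : Fin m → ℂ} (hx₀ : x₀ ≠ 0) (hAx₀ : A *ᵥ x₀ = 0) :
    ∃ (d : ℕ) (x : ℕ → Fin m → ℂ), 0 < d ∧ x 0 ≠ 0 ∧ A *ᵥ x 0 = 0 ∧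
      (∀ i, i + 1 < d → A *ᵥ x (i + 1) = B *ᵥ x i) ∧
      ¬ ∃ y : ℕ → Fin m → ℂ, y 0 ≠ 0 ∧ A *ᵥ y 0 = 0 ∧
        ∀ i, i + 1 < d + 1 → A *ᵥ y (i + 1) = B *ᵥ y i := by
  classical
  let p : ℕ → Prop := fun d => ¬ ∃ y : ℕ → Fin m → ℂ, y 0 ≠ 0 ∧ A *ᵥ y 0 = 0 ∧
        ∀ i, i + 1 < d + 1 → A *ᵥ y (i + 1) = B *ᵥ y i
  have hp : ∃ d, p d :=
    ⟨m, fun ⟨y, h1, h2, h3⟩ => hno (exists_nullChain_of_long_chain h1 h2 h3)⟩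
  have h0 : ¬ p 0 := fun h => h ⟨fun _ => x₀, hx₀, hAx₀, fun i hi => absurd hi (by omega)⟩
  have h1 := Nat.find_spec hp
  have h2 : ∀ d, d < Nat.find hp → ¬ p d := fun d => Nat.find_min hp
  rcases hd : Nat.find hp with _ | d
  · rw [hd] at h1
    exact absurd h1 h0
  · rw [hd] at h1
    obtain ⟨x, hx1, hx2, hx3⟩ := not_not.1 (h2 d (by omega))
    exact ⟨d + 1, x, Nat.succ_pos d, hx1, hx2, hx3, h1⟩

theorem mul_jordanBlock_zero {ι : Type*} {d : ℕ} (Y : Matrix ι (Fin d) ℂ) (a : ι) (h : 0 < d) :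
    (Y * jordanBlock 0 d) a ⟨0, h⟩ = 0 := by
  rw [Matrix.mul_apply]
  exact Finset.sum_eq_zero fun i _ => by simp [jordanBlock]

theorem mul_jordanBlock_succ {ι : Type*} {d : ℕ} (Y : Matrix ι (Fin d) ℂ) (a : ι) (l : ℕ)
    (h : l + 1 < d) :
    (Y * jordanBlock 0 d) a ⟨l + 1, h⟩ = Y a ⟨l, Nat.lt_of_succ_lt h⟩ := by
  rw [Matrix.mul_apply, Finset.sum_eq_single (⟨l, Nat.lt_of_succ_lt h⟩ : Fin d)]
  · simp [jordanBlock]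
  · intro i _ hi
    have : (i : ℕ) ≠ l := fun h => hi (Fin.ext h)
    simp [jordanBlock, this]
  · simp

theorem jordanBlock_mul {κ : Type*} {d : ℕ} (Φ : Matrix (Fin d) κ ℂ) (i : Fin d) (a : κ) :
    (jordanBlock 0 d * Φ) i a = if h : (i : ℕ) + 1 < d then Φ ⟨i + 1, h⟩ a else 0 := by
  rw [Matrix.mul_apply]
  split_ifs with hi
  · rw [Finset.sum_eq_single (⟨i + 1, hi⟩ : Fin d)]
    · simp [jordanBlock, Fin.ext_iff]
    · intro l _ hl
      have : (i : ℕ) + 1 ≠ l := fun h => hl (Fin.ext h.symm)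
      simp [jordanBlock, this]
    · simp
  · refine Finset.sum_eq_zero fun l _ => ?_
    have : (i : ℕ) + 1 ≠ l := by omega
    simp [jordanBlock, this]

/-- Take a longest chain over all starting vectors in ker A. It cannot be extended, so a dual chain
with ψ 0 ⬝ B x₀ = 1 exists. The pairing matrix is upper triangular with ones on the diagonal, and ψ
d = 0 closes the Jordan block. -/
theorem exists_split_regular {A B : Matrix (Fin n) (Fin m) ℂ} (hno : ¬ ∃ d, HasNullChain A B d)
    {x₀ : Fin m → ℂ} (hx₀ : x₀ ≠ 0) (hAx₀ : A *ᵥ x₀ = 0) :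
    ∃ (d n' m' : ℕ) (A' B' : Matrix (Fin n') (Fin m') ℂ), 0 < d ∧ n' + d = n ∧ m' + d = m ∧
      StrictEquiv A B (fromBlocks (jordanBlock 0 d) 0 0 A')
        (fromBlocks (1 : Matrix (Fin d) (Fin d) ℂ) 0 0 B') := by
  obtain ⟨d, x, hd, hx0, hx1, hx, hmax⟩ := exists_maximal_chain hno hx₀ hAx₀
  obtain ⟨ψ, h1, h2, h3⟩ := exists_dual_sequence A B (B *ᵥ x 0) d ⊤ (by
    rintro ⟨v, -, hv0, hv⟩
    -- A solution of the system, preceded by x 0, would be a chain of length d + 1.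
    refine hmax ⟨fun i => if i = 0 then x 0 else v (i - 1), by simpa using hx0, by simpa using hx1,
      fun i hi => ?_⟩
    rcases i with _ | i
    · simpa using hv0 hd
    · simpa using hv i (by omega))
  have hψ : ∀ i v, ψ i ⬝ᵥ A *ᵥ v = ψ (i + 1) ⬝ᵥ B *ᵥ v := fun i v => h3 i v trivial
  have hψA : ∀ i, ψ i ᵥ* A = ψ (i + 1) ᵥ* B := fun i => by
    refine dotProduct_eq _ _ fun v => ?_
    rw [← Matrix.dotProduct_mulVec, ← Matrix.dotProduct_mulVec, hψ]
  have ht := dual_sequence_dotProduct hx1 hx fun i v _ => hψ i v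
  have hunit : ∀ M : Matrix (Fin d) (Fin d) ℂ, (∀ i l, M i l = ψ i ⬝ᵥ B *ᵥ x l) →
      IsUnit M.det := by
    intro M hM
    rw [Matrix.det_of_isUpperTriangular]
    · rw [Finset.prod_eq_one]
      · exact isUnit_one
      · intro i _
        rw [hM, ht i i i.2 i.2]
        simpa using h1
    · intro i l hil
      rw [hM, ht i l i.2 l.2, if_neg (by simpa using hil)]
  obtain ⟨n', m', A', B', hn, hm, h⟩ := exists_strictEquiv_fromBlocks
    (A := A) (B := B) (X := Matrix.of fun c (l : Fin d) => x l c)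
    (Y := Matrix.of fun c (l : Fin d) => (B *ᵥ x l) c)
    (Φ := Matrix.of fun (i : Fin d) c => (ψ i ᵥ* B) c)
    (Ψ := Matrix.of fun (i : Fin d) c => ψ i c) (E := jordanBlock 0 d) (F := 1)
    (by
      ext a ⟨l, hl⟩
      rcases l with _ | l
      · rw [mul_jordanBlock_zero]
        exact congrFun hx1 a
      · rw [mul_jordanBlock_succ]
        exact congrFun (hx l hl) a)
    (by rw [Matrix.mul_one]; rfl)
    (by
      ext i a
      rw [jordanBlock_mul]
      split_ifs with hi
      · exact congrFun (hψA i) a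
      · refine (congrFun (hψA i) a).trans ?_
        rw [h2 _ (not_lt.1 hi), Matrix.zero_vecMul]
        rfl)
    (by rw [Matrix.one_mul]; rfl)
    (hunit _ fun i l => (Matrix.dotProduct_mulVec (ψ i) B (x l)).symm)
    (hunit _ fun i l => rfl)
  exact ⟨d, n', m', A', B', hd, by simpa using hn, by simpa using hm, h⟩

theorem HasNullChain.swap {A B : Matrix (Fin n) (Fin m) ℂ} {d : ℕ} (h : HasNullChain A B d) :
    HasNullChain B A d := by
  obtain ⟨x, hx, hx0, hxz⟩ := h
  -- Interchanging A and B reverses the coefficients of a polynomial null vector.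
  refine ⟨fun i => if i ≤ d then x (d - i) else 0, ⟨?_, fun i => ?_⟩, fun h => hx0 ?_,
    fun i hi => if_neg (by omega)⟩
  · simp only [Nat.zero_le, if_true, Nat.sub_zero]
    rw [← hx.2 d, hxz _ (Nat.lt_succ_self d), Matrix.mulVec_zero]
  · rcases lt_trichotomy i d with h | rfl | h
    · simp only [if_pos (show i + 1 ≤ d by omega), if_pos h.le]
      rw [← hx.2, show d - (i + 1) + 1 = d - i by omega]
    · simp [hx.1]
    · simp [show ¬ i + 1 ≤ d by omega, show ¬ i ≤ d by omega]
  · funext i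
    by_cases hi : i ≤ d
    · have := congrFun h (d - i)
      simpa [show d - (d - i) = i by omega] using this
    · exact hxz i (by omega)

theorem not_hasNullChain_of_injective {A B : Matrix (Fin n) (Fin m) ℂ}
    (hB : ∀ v, B *ᵥ v = 0 → v = 0) : ¬ ∃ d, HasNullChain A B d := by
  rintro ⟨d, x, hx, hx0, hxz⟩
  have key : ∀ k i, d < i + k → x i = 0 := by
    intro k
    induction k with
    | zero => exact hxz
    | succ k ih =>
      intro i hi
      apply hB
      rw [← hx.2 i, ih (i + 1) (by omega), Matrix.mulVec_zero]
  exact hx0 (funext fun i => key (d + 1) i (by omega))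

/-- A null vector of degree at most n has (n + 1) m unknown coefficients and satisfies (n + 2) n
equations; n (n + 2) < (n + 1)² ≤ (n + 1) m. -/
theorem exists_hasNullChain_of_lt (h : n < m) (A B : Matrix (Fin n) (Fin m) ℂ) :
    ∃ d, HasNullChain A B d := by
  let e : ℕ → (Fin (n + 1) → Fin m → ℂ) →ₗ[ℂ] (Fin m → ℂ) := fun i =>
    if h : i < n + 1 then LinearMap.proj ⟨i, h⟩ else 0
  have he : ∀ i, ¬ i < n + 1 → e i = 0 := fun i hi => dif_neg hi
  have he' : ∀ i : Fin (n + 1), e i = LinearMap.proj i := fun i => dif_pos i.2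
  let e' : ℕ → (Fin (n + 1) → Fin m → ℂ) →ₗ[ℂ] (Fin m → ℂ) := fun i =>
    if i = 0 then 0 else e (i - 1)
  let T : (Fin (n + 1) → Fin m → ℂ) →ₗ[ℂ] (Fin (n + 2) → Fin n → ℂ) :=
    LinearMap.pi fun i => A.mulVecLin ∘ₗ e i - B.mulVecLin ∘ₗ e' i
  have hT : LinearMap.ker T ≠ ⊥ := by
    apply LinearMap.ker_ne_bot_of_finrank_lt
    simp only [Module.finrank_pi_fintype, Module.finrank_self, Finset.sum_const, Finset.card_univ,
      Fintype.card_fin, smul_eq_mul, mul_one]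
    nlinarith
  obtain ⟨v, hv, hv0⟩ := (Submodule.ne_bot_iff _).1 hT
  have hTv : ∀ i, i < n + 2 → A *ᵥ e i v = B *ᵥ e' i v := by
    intro i hi
    have := congrFun (LinearMap.mem_ker.1 hv) ⟨i, hi⟩
    exact sub_eq_zero.1 this
  refine ⟨n, fun i => e i v, ⟨?_, fun i => ?_⟩, fun h0 => hv0 ?_, fun i hi => ?_⟩
  · simpa [e'] using hTv 0 (by omega)
  · by_cases hi : i + 1 < n + 2
    · simpa [e'] using hTv (i + 1) hi
    · simp [he i (by omega), he (i + 1) (by omega)]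
  · funext i
    have := congrFun h0 i
    simpa [he'] using this
  · simp [he i (by omega)]

end Regular

/-! ### Existence of the Kronecker canonical form. -/

section Existence

theorem StrictEquiv.swap {ι κ ι' κ' : Type*} [Fintype ι] [Fintype κ] [Fintype ι'] [Fintype κ']
    [DecidableEq ι] [DecidableEq κ] [DecidableEq ι'] [DecidableEq κ']
    {A B : Matrix ι κ ℂ} {A' B' : Matrix ι' κ' ℂ} (h : StrictEquiv A B A' B') :
    StrictEquiv B A B' A' := by
  obtain ⟨P, P', Q, Q', h1, h2, h3, h4, h5, h6⟩ := h
  exact ⟨P, P', Q, Q', h1, h2, h3, h4, h6, h5⟩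

theorem StrictEquiv.add_smul {ι κ ι' κ' : Type*} [Fintype ι] [Fintype κ] [Fintype ι']
    [Fintype κ'] [DecidableEq ι] [DecidableEq κ] [DecidableEq ι'] [DecidableEq κ']
    {A B : Matrix ι κ ℂ} {A' B' : Matrix ι' κ' ℂ} (h : StrictEquiv A B A' B') (ζ : ℂ) :
    StrictEquiv (A + ζ • B) B (A' + ζ • B') B' := by
  obtain ⟨P, P', Q, Q', h1, h2, h3, h4, rfl, rfl⟩ := h
  exact ⟨P, P', Q, Q', h1, h2, h3, h4, by simp [Matrix.mul_add, Matrix.add_mul], rfl⟩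

theorem jordanBlock_add_smul (ζ : ℂ) (d : ℕ) :
    jordanBlock 0 d + ζ • (1 : Matrix (Fin d) (Fin d) ℂ) = jordanBlock ζ d := by
  ext i j
  by_cases h : i = j
  · simp [jordanBlock, h]
  · simp [jordanBlock, h]

/-- Every square pencil without polynomial null vectors splits off a regular block. -/
theorem exists_split_regularBlock {n m : ℕ} (hm : 0 < m) {A B : Matrix (Fin n) (Fin m) ℂ}
    (h : ¬ ∃ d, HasNullChain A B d) (h' : ¬ ∃ d, HasNullChain Aᵀ Bᵀ d) :
    ∃ (b : RegularBlock) (n' m' : ℕ) (A' B' : Matrix (Fin n') (Fin m') ℂ),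
      n' + b.size = n ∧ m' + b.size = m ∧
      StrictEquiv A B (fromBlocks (KroneckerBlock.regular b).matE 0 0 A')
        (fromBlocks (KroneckerBlock.regular b).matF 0 0 B') := by
  by_cases hB : ∀ v, B *ᵥ v = 0 → v = 0
  -- A tall pencil has a wide transpose, which always has a polynomial null vector.
  · have hnm : n ≤ m := not_lt.1 fun hlt => h' (exists_hasNullChain_of_lt hlt _ _)
    have hinj : Function.Injective B.mulVecLin :=
      (injective_iff_map_eq_zero B.mulVecLin).2 hB
    have hmn : m ≤ n := by simpa using LinearMap.finrank_le_finrank_of_injective hinj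
    obtain rfl : n = m := le_antisymm hnm hmn
    have hBu : IsUnit B.det := (Matrix.isUnit_iff_isUnit_det B).1
      (Matrix.mulVec_injective_iff_isUnit.1 hinj)
    have : NeZero n := ⟨hm.ne'⟩
    obtain ⟨ζ, hζ⟩ := Module.End.exists_eigenvalue (Matrix.toLin' (B⁻¹ * A))
    obtain ⟨x, hx, hx0⟩ := hζ.exists_hasEigenvector
    have hx1 : (B⁻¹ * A) *ᵥ x = ζ • x := by simpa [Module.End.mem_eigenspace_iff] using hx
    have hx2 : (A - ζ • B) *ᵥ x = 0 := by
      have := congrArg (B *ᵥ ·) hx1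
      simp only [Matrix.mulVec_mulVec, Matrix.mulVec_smul] at this
      rw [← Matrix.mul_assoc, Matrix.mul_nonsing_inv _ hBu, Matrix.one_mul] at this
      rw [Matrix.sub_mulVec, this, Matrix.smul_mulVec, sub_self]
    obtain ⟨d, n', m', A', B', hd, hn', hm', hs⟩ :=
      exists_split_regular (not_hasNullChain_of_injective hB) hx0 hx2
    refine ⟨⟨(ζ : OnePoint ℂ), d, hd⟩, n', m', A' + ζ • B', B', hn', hm', ?_⟩
    have := hs.add_smul ζ
    rw [sub_add_cancel, Matrix.fromBlocks_smul, Matrix.fromBlocks_add, jordanBlock_add_smul] at this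
    simp only [smul_zero, add_zero] at this
    exact this
  · push Not at hB
    obtain ⟨x, hx, hx0⟩ := hB
    -- A null vector of B is an eigenvector at infinity, that is, at 0 for the pencil with A and B
    -- interchanged.
    obtain ⟨d, n', m', A', B', hd, hn', hm', hs⟩ :=
      exists_split_regular (fun ⟨d, hd⟩ => h ⟨d, hd.swap⟩) hx0 hx
    exact ⟨⟨OnePoint.infty, d, hd⟩, n', m', B', A', hn', hm', hs.swap⟩

theorem exists_hasBlocks (N : ℕ) : ∀ (n m : ℕ), n + m = N → ∀ A B : Matrix (Fin n) (Fin m) ℂ,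
    ∃ S, HasBlocks A B S := by
  -- Induction on rows plus columns, because L_0 uses a column but no row.
  induction N using Nat.strong_induction_on with
  | _ N ih =>
  intro n m hN A B
  by_cases h : ∃ d, HasNullChain A B d
  · obtain ⟨j, n', m', A', B', hn, hm, hs⟩ := exists_split_right h
    obtain ⟨S, hS⟩ := ih (n' + m') (by omega) n' m' rfl A' B'
    exact ⟨_, HasBlocks.of_strictEquiv hs
      (HasBlocks.fromBlocks (hasBlocks_singleton (KroneckerBlock.right j)) hS)⟩
  by_cases h' : ∃ d, HasNullChain Aᵀ Bᵀ d
  · obtain ⟨j, m', n', A', B', hm, hn, hs⟩ := exists_split_right h'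
    obtain ⟨S, hS⟩ := ih (n' + m') (by omega) n' m' rfl A'ᵀ B'ᵀ
    have hs' := hs.transpose
    rw [Matrix.fromBlocks_transpose, Matrix.fromBlocks_transpose, Matrix.transpose_transpose,
      Matrix.transpose_transpose, Matrix.transpose_zero, Matrix.transpose_zero] at hs'
    exact ⟨_, HasBlocks.of_strictEquiv hs'
      (HasBlocks.fromBlocks (hasBlocks_singleton (KroneckerBlock.left j)) hS)⟩
  rcases Nat.eq_zero_or_pos m with rfl | hm
  · rcases Nat.eq_zero_or_pos n with rfl | hn
    · exact ⟨0, hasBlocks_zero A B⟩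
    · exact absurd (exists_hasNullChain_of_lt hn Aᵀ Bᵀ) h'
  · obtain ⟨b, n', m', A', B', hn', hm', hs⟩ := exists_split_regularBlock hm h h'
    have := b.size_pos
    obtain ⟨S, hS⟩ := ih (n' + m') (by omega) n' m' rfl A' B'
    exact ⟨_, HasBlocks.of_strictEquiv hs
      (HasBlocks.fromBlocks (hasBlocks_singleton (KroneckerBlock.regular b)) hS)⟩

theorem exists_coe_kroneckerBlocks_eq (S : Multiset KroneckerBlock) :
    ∃ R rt lf, (kroneckerBlocks R rt lf : Multiset KroneckerBlock) = S := by
  induction S using Multiset.induction with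
  | empty => exact ⟨[], [], [], rfl⟩
  | cons b S ih =>
    obtain ⟨R, rt, lf, rfl⟩ := ih
    cases b with
    | regular b => exact ⟨b :: R, rt, lf, rfl⟩
    | right j =>
      refine ⟨R, j :: rt, lf, ?_⟩
      simp only [kroneckerBlocks, List.map_cons, ← Multiset.coe_add, ← Multiset.cons_coe,
        Multiset.add_cons, Multiset.cons_add]
    | left j =>
      refine ⟨R, rt, j :: lf, ?_⟩
      simp only [kroneckerBlocks, List.map_cons, ← Multiset.coe_add, ← Multiset.cons_coe,
        Multiset.add_cons]

/-- Every pencil has a Kronecker canonical form. -/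
theorem exists_isRegularPart {n m : ℕ} (A B : Matrix (Fin n) (Fin m) ℂ) :
    ∃ R, IsRegularPart A B R := by
  obtain ⟨S, hS⟩ := exists_hasBlocks _ n m rfl A B
  obtain ⟨R, rt, lf, rfl⟩ := exists_coe_kroneckerBlocks_eq S
  exact ⟨R, rt, lf, hasKroneckerForm_iff.2 hS⟩

end Existence

/-! ### Rank factorization and ranks of block diagonal matrices. -/

section RankFactorization

variable {ι κ ρ : Type*} [Fintype ι] [Fintype κ] [Fintype ρ] [DecidableEq ι] [DecidableEq κ]
  [DecidableEq ρ]

theorem exists_mul_eq_one_of_injective {L : Matrix ι ρ ℂ} (h : Function.Injective L.mulVecLin) :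
    ∃ G : Matrix ρ ι ℂ, G * L = 1 := by
  obtain ⟨g, hg⟩ := LinearMap.exists_leftInverse_of_injective _ (LinearMap.ker_eq_bot.2 h)
  refine ⟨LinearMap.toMatrix' g, ?_⟩
  rw [← LinearMap.toMatrix'_id, ← hg, LinearMap.toMatrix'_comp]
  congr 1
  exact (LinearMap.toMatrix'_toLin' L).symm

theorem exists_mul_eq_one_of_surjective {R : Matrix ρ ι ℂ} (h : Function.Surjective R.mulVecLin) :
    ∃ H : Matrix ι ρ ℂ, R * H = 1 := by
  obtain ⟨g, hg⟩ := LinearMap.exists_rightInverse_of_surjective _ (LinearMap.range_eq_top.2 h)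
  refine ⟨LinearMap.toMatrix' g, ?_⟩
  rw [← LinearMap.toMatrix'_id, ← hg, LinearMap.toMatrix'_comp]
  congr 1
  exact (LinearMap.toMatrix'_toLin' R).symm

theorem exists_rank_factorization (M : Matrix ι κ ℂ) :
    ∃ (L : Matrix ι (Fin M.rank) ℂ) (R : Matrix (Fin M.rank) κ ℂ)
      (G : Matrix (Fin M.rank) ι ℂ) (H : Matrix κ (Fin M.rank) ℂ),
      M = L * R ∧ G * M * H = 1 := by
  let V := LinearMap.range M.mulVecLin
  let b : Module.Basis (Fin M.rank) ℂ V := Module.finBasis ℂ V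
  let l : (Fin M.rank → ℂ) →ₗ[ℂ] (ι → ℂ) := V.subtype ∘ₗ b.equivFun.symm.toLinearMap
  let r : (κ → ℂ) →ₗ[ℂ] (Fin M.rank → ℂ) := b.equivFun.toLinearMap ∘ₗ M.mulVecLin.rangeRestrict
  have hlr : l ∘ₗ r = M.mulVecLin := by
    refine LinearMap.ext fun v => ?_
    change ((b.equivFun.symm (b.equivFun (M.mulVecLin.rangeRestrict v)) : V) : ι → ℂ) = _
    rw [LinearEquiv.symm_apply_apply]
    rfl
  have hM : M = LinearMap.toMatrix' l * LinearMap.toMatrix' r := by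
    rw [← LinearMap.toMatrix'_comp, hlr, ← Matrix.toLin'_apply', LinearMap.toMatrix'_toLin']
  have hl : Function.Injective (LinearMap.toMatrix' l).mulVecLin := by
    rw [← Matrix.toLin'_apply', Matrix.toLin'_toMatrix']
    exact V.injective_subtype.comp b.equivFun.symm.injective
  have hr : Function.Surjective (LinearMap.toMatrix' r).mulVecLin := by
    rw [← Matrix.toLin'_apply', Matrix.toLin'_toMatrix']
    exact b.equivFun.surjective.comp M.mulVecLin.surjective_rangeRestrict
  obtain ⟨G, hG⟩ := exists_mul_eq_one_of_injective hl
  obtain ⟨H, hH⟩ := exists_mul_eq_one_of_surjective hr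
  refine ⟨_, _, G, H, hM, ?_⟩
  have h : G * M = LinearMap.toMatrix' r := by
    rw [(congrArg (G * ·) hM : G * M = _), ← Matrix.mul_assoc, hG, Matrix.one_mul]
  rw [h, hH]

theorem card_le_rank_of_mul_mul_eq_one {M : Matrix ι κ ℂ} {G : Matrix ρ ι ℂ} {H : Matrix κ ρ ℂ}
    (h : G * M * H = 1) : Fintype.card ρ ≤ M.rank := by
  rw [← Matrix.rank_one (R := ℂ) (n := ρ), ← h]
  exact (Matrix.rank_mul_le_left _ _).trans (Matrix.rank_mul_le_right _ _)

theorem rank_mul_le_card (L : Matrix ι ρ ℂ) (R : Matrix ρ κ ℂ) :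
    (L * R).rank ≤ Fintype.card ρ :=
  (Matrix.rank_mul_le_left _ _).trans (Matrix.rank_le_card_width _)

/-- Block diagonal factors M = L R bound the rank from above, and block diagonal G, H with G M H = 1
bound it from below. -/
theorem rank_blockDiagonal' {τ : Type*} [Fintype τ] [DecidableEq τ] {m n : τ → Type*}
    [∀ i, Fintype (m i)] [∀ i, Fintype (n i)] [∀ i, DecidableEq (m i)] [∀ i, DecidableEq (n i)]
    (M : ∀ i, Matrix (m i) (n i) ℂ) :
    (Matrix.blockDiagonal' M).rank = ∑ i, (M i).rank := by
  choose L R G H h1 h2 using fun i => exists_rank_factorization (M i)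
  have hc : Fintype.card (Σ i, Fin (M i).rank) = ∑ i, (M i).rank := by simp
  apply le_antisymm
  · rw [← hc, show Matrix.blockDiagonal' M = Matrix.blockDiagonal' L * Matrix.blockDiagonal' R by
      rw [← Matrix.blockDiagonal'_mul]; exact congrArg _ (funext h1)]
    exact rank_mul_le_card _ _
  · rw [← hc]
    refine card_le_rank_of_mul_mul_eq_one (G := Matrix.blockDiagonal' G)
      (H := Matrix.blockDiagonal' H) ?_
    rw [← Matrix.blockDiagonal'_mul, ← Matrix.blockDiagonal'_mul, ← Matrix.blockDiagonal'_one]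
    exact congrArg _ (funext h2)

theorem mulVec_surjective_of_rank {M : Matrix ι κ ℂ} (h : M.rank = Fintype.card ι) :
    Function.Surjective M.mulVecLin := by
  rw [← LinearMap.range_eq_top]
  apply Submodule.eq_top_of_finrank_eq
  rw [Module.finrank_pi]
  exact h

end RankFactorization

/-! ### Ranks of Kronecker blocks at finite points and at infinity. -/

section PencilValue

variable {ι κ ι' κ' : Type*} [Fintype ι] [Fintype κ] [Fintype ι'] [Fintype κ'] [DecidableEq ι]
  [DecidableEq κ] [DecidableEq ι'] [DecidableEq κ']

/-- The value of the pencil `A - λ B` at a point of `ℂ ∪ {∞}`, for arbitrary index types. -/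
def pencilValue (A B : Matrix ι κ ℂ) (μ : OnePoint ℂ) : Matrix ι κ ℂ :=
  μ.elim B (fun ζ => A - ζ • B)

@[simp] theorem pencilValue_coe (A B : Matrix ι κ ℂ) (ζ : ℂ) : pencilValue A B ζ = A - ζ • B := rfl

theorem pencilValue_mul_mul (A B : Matrix ι κ ℂ) (P : Matrix ι' ι ℂ) (Q : Matrix κ κ' ℂ)
    (μ : OnePoint ℂ) : pencilValue (P * A * Q) (P * B * Q) μ = P * pencilValue A B μ * Q := by
  induction μ using OnePoint.rec with
  | infty => rfl
  | coe ζ => simp [Matrix.mul_sub, Matrix.sub_mul]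

theorem StrictEquiv.rank_eq {A B : Matrix ι κ ℂ} {A' B' : Matrix ι' κ' ℂ}
    (h : StrictEquiv A B A' B') (μ : OnePoint ℂ) :
    (pencilValue A B μ).rank = (pencilValue A' B' μ).rank := by
  obtain ⟨P, P', Q, Q', h1, h2, h3, h4, rfl, rfl⟩ := h
  rw [pencilValue_mul_mul, rank_mul_mul_of_inverses h2 h3]

theorem pencilValue_blocks {τ : Type*} [DecidableEq τ] (b : τ → KroneckerBlock) (μ : OnePoint ℂ) :
    pencilValue (blocksE b) (blocksF b) μ =
      Matrix.blockDiagonal' fun i => pencilValue (b i).matE (b i).matF μ := by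
  induction μ using OnePoint.rec with
  | infty => rfl
  | coe ζ =>
    simp only [pencilValue_coe, blocksE, blocksF, ← Matrix.blockDiagonal'_smul,
      ← Matrix.blockDiagonal'_sub]
    rfl

theorem jordanBlock_zero_succ (d : ℕ) : jordanBlock 0 (d + 1) = (rightF d)ᵀ * rightE d := by
  ext i j
  rw [Matrix.mul_apply]
  simp only [Matrix.transpose_apply, rightF, rightE, Matrix.of_apply, jordanBlock]
  refine Fin.lastCases ?_ (fun i => ?_) i
  · rw [Finset.sum_eq_zero]
    · have : ¬ (d + 1 = (j : ℕ)) := by omega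
      simp [this]
    · intro l _
      simp [(Fin.castSucc_lt_last l).ne']
  · rw [Finset.sum_eq_single i]
    · by_cases h : (i : ℕ) + 1 = j
      · have : j = i.succ := Fin.ext h.symm
        simp [this, Fin.ext_iff]
      · have : j ≠ i.succ := fun h' => h (by simp [h'])
        simp [h, this]
    · intro l _ hl
      simp [hl.symm]
    · simp

theorem rank_jordanBlock_zero {d : ℕ} (hd : 0 < d) : (jordanBlock 0 d).rank = d - 1 := by
  obtain ⟨d, rfl⟩ := Nat.exists_eq_succ_of_ne_zero hd.ne'
  rw [Nat.succ_eq_add_one, Nat.add_sub_cancel]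
  apply le_antisymm
  · rw [jordanBlock_zero_succ]
    simpa using rank_mul_le_card (rightF d)ᵀ (rightE d)
  · have h : (jordanBlock 0 (d + 1)).submatrix Fin.castSucc Fin.succ = 1 := by
      ext i j
      have h1 : i.castSucc = j.succ → ¬ ((i : ℕ) = j) := by simp [Fin.ext_iff]; omega
      by_cases h : i = j
      · subst h; simp [jordanBlock, Fin.ext_iff]
      · have : (i : ℕ) ≠ j := fun h' => h (Fin.ext h')
        simp [jordanBlock, h, this]
    have := Matrix.rank_submatrix_le (jordanBlock 0 (d + 1)) Fin.castSucc Fin.succ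
    rw [h, Matrix.rank_one, Fintype.card_fin] at this
    exact this

theorem rank_of_isUpperTriangular {d : ℕ} {M : Matrix (Fin d) (Fin d) ℂ}
    (h : ∀ i j, j < i → M i j = 0) (h' : ∀ i, M i i ≠ 0) : M.rank = d := by
  have : M.det ≠ 0 := by
    rw [Matrix.det_of_isUpperTriangular (fun i j hij => h i j hij)]
    exact Finset.prod_ne_zero_iff.2 fun i _ => h' i
  simpa using Matrix.rank_of_det_ne_zero this

theorem rank_one_sub_smul_jordanBlock (ζ : ℂ) (d : ℕ) :
    (1 - ζ • jordanBlock 0 d).rank = d := by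
  refine rank_of_isUpperTriangular (fun i j hij => ?_) fun i => ?_
  · have h1 : i ≠ j := hij.ne'
    have h2 : (i : ℕ) + 1 ≠ j := by have : (j : ℕ) < i := hij; omega
    simp [jordanBlock, h1, h2]
  · simp [jordanBlock]

theorem rank_jordanBlock_sub_smul {ν ζ : ℂ} (h : ν ≠ ζ) (d : ℕ) :
    (jordanBlock ν d - ζ • (1 : Matrix (Fin d) (Fin d) ℂ)).rank = d := by
  refine rank_of_isUpperTriangular (fun i j hij => ?_) fun i => ?_
  · have h1 : i ≠ j := hij.ne'
    have h2 : (i : ℕ) + 1 ≠ j := by have : (j : ℕ) < i := hij; omega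
    simp [jordanBlock, h1, h2]
  · simpa [jordanBlock] using sub_ne_zero.2 h

open Classical in
theorem rank_regularBlock (b : RegularBlock) (μ : OnePoint ℂ) :
    (pencilValue (KroneckerBlock.regular b).matE (KroneckerBlock.regular b).matF μ).rank =
      if b.eigenvalue = μ then b.size - 1 else b.size := by
  obtain ⟨ν, d, hd⟩ := b
  induction ν using OnePoint.rec with
  | infty =>
    induction μ using OnePoint.rec with
    | infty =>
      refine Eq.trans ?_ (if_pos rfl).symm
      exact rank_jordanBlock_zero hd
    | coe ζ =>
      refine Eq.trans ?_ (if_neg (OnePoint.infty_ne_coe ζ)).symm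
      exact rank_one_sub_smul_jordanBlock ζ d
  | coe ν =>
    induction μ using OnePoint.rec with
    | infty =>
      refine Eq.trans ?_ (if_neg (OnePoint.coe_ne_infty ν)).symm
      exact (Matrix.rank_one (R := ℂ) (n := Fin d)).trans (Fintype.card_fin d)
    | coe ζ =>
      by_cases h : ν = ζ
      · subst h
        refine Eq.trans ?_ (if_pos rfl).symm
        have : jordanBlock ν d - ν • (1 : Matrix (Fin d) (Fin d) ℂ) = jordanBlock 0 d := by
          rw [← jordanBlock_add_smul, add_sub_cancel_right]
        exact (congrArg Matrix.rank this).trans (rank_jordanBlock_zero hd)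
      · refine Eq.trans ?_ (if_neg (fun h' => h (OnePoint.coe_injective h'))).symm
        exact rank_jordanBlock_sub_smul h d

theorem rank_rightBlock (j : ℕ) (μ : OnePoint ℂ) : (pencilValue (rightE j) (rightF j) μ).rank = j := by
  apply le_antisymm
  · simpa using Matrix.rank_le_card_height (pencilValue (rightE j) (rightF j) μ)
  induction μ using OnePoint.rec with
  | infty =>
    have h : (rightF j).submatrix id Fin.castSucc = 1 := by
      ext i l
      simp [rightF, Matrix.one_apply, eq_comm]
    have := Matrix.rank_submatrix_le (rightF j) id Fin.castSucc
    rw [h, Matrix.rank_one, Fintype.card_fin] at this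
    exact this
  | coe ζ =>
    have h : (((rightE j - ζ • rightF j).submatrix id Fin.succ)ᵀ).rank = j := by
      refine rank_of_isUpperTriangular (fun i l hil => ?_) fun i => ?_
      · have h1 : i ≠ l := hil.ne'
        have h2 : i.succ ≠ l.castSucc := by
          have : (l : ℕ) < i := hil
          simp only [ne_eq, Fin.ext_iff, Fin.val_succ, Fin.val_castSucc]
          omega
        simp [rightE, rightF, h1, h2]
      · have h2 : i.succ ≠ i.castSucc := by simp [Fin.ext_iff]
        simp [rightE, rightF, h2]
    rw [Matrix.rank_transpose] at h
    rw [pencilValue_coe]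
    conv_lhs => rw [← h]
    exact Matrix.rank_submatrix_le _ _ _

theorem pencilValue_transpose (A B : Matrix ι κ ℂ) (μ : OnePoint ℂ) :
    pencilValue Aᵀ Bᵀ μ = (pencilValue A B μ)ᵀ := by
  induction μ using OnePoint.rec with
  | infty => rfl
  | coe ζ => simp

open Classical in
/-- The rank of a Kronecker block at a point of `ℂ ∪ {∞}`. -/
def blockRank (μ : OnePoint ℂ) : KroneckerBlock → ℕ
  | .regular b => if b.eigenvalue = μ then b.size - 1 else b.size
  | .right j => j
  | .left j => j

theorem rank_pencilValue_block (b : KroneckerBlock) (μ : OnePoint ℂ) :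
    (pencilValue b.matE b.matF μ).rank = blockRank μ b := by
  classical
  cases b with
  | regular b => exact (rank_regularBlock b μ).trans (by simp only [blockRank])
  | right j => exact rank_rightBlock j μ
  | left j =>
    have : pencilValue (KroneckerBlock.left j).matE (KroneckerBlock.left j).matF μ =
      (pencilValue (rightE j) (rightF j) μ)ᵀ := pencilValue_transpose _ _ μ
    rw [this]
    exact (Matrix.rank_transpose _).trans (rank_rightBlock j μ)

theorem HasBlocks.rank_pencilValue {A B : Matrix ι κ ℂ} {S : Multiset KroneckerBlock}
    (h : HasBlocks A B S) (μ : OnePoint ℂ) :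
    (pencilValue A B μ).rank = (S.map (blockRank μ)).sum := by
  obtain ⟨l, rfl, h⟩ := h
  rw [h.rank_eq, pencilValue_blocks, rank_blockDiagonal', ← univ_map_get l, Multiset.map_map]
  exact Finset.sum_congr rfl fun i _ => rank_pencilValue_block _ _

open Classical in
-- Each Jordan block at μ lowers the rank by exactly one, whatever its size, and no other block
-- loses rank at μ. The right-hand side is independent of μ; it turns out to be the normal rank.
theorem HasBlocks.rank_add_countP {A B : Matrix ι κ ℂ} {R : List RegularBlock} {rt lf : List ℕ}
    (h : HasBlocks A B (kroneckerBlocks R rt lf : Multiset KroneckerBlock)) (μ : OnePoint ℂ) :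
    (pencilValue A B μ).rank + R.countP (fun b => b.eigenvalue = μ) =
      (R.map RegularBlock.size).sum + rt.sum + lf.sum := by
  rw [h.rank_pencilValue, Multiset.map_coe, Multiset.sum_coe]
  simp only [kroneckerBlocks, List.map_append, List.map_map, List.sum_append]
  have h1 : (rt.map (blockRank μ ∘ KroneckerBlock.right)).sum = rt.sum :=
    congrArg List.sum (List.map_id' rt)
  have h2 : (lf.map (blockRank μ ∘ KroneckerBlock.left)).sum = lf.sum :=
    congrArg List.sum (List.map_id' lf)
  have h3 : (R.map (blockRank μ ∘ KroneckerBlock.regular)).sum +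
      R.countP (fun b => b.eigenvalue = μ) = (R.map RegularBlock.size).sum := by
    clear h
    induction R with
    | nil => rfl
    | cons b R ih =>
      have := b.size_pos
      simp only [List.map_cons, List.sum_cons, List.countP_cons, Function.comp_apply, blockRank,
        decide_eq_true_eq] at ih ⊢
      split_ifs <;> omega
  omega

end PencilValue

/-! ### Normal rank and eigenvalues read off the Kronecker form. -/

section Eigenvalues

variable {n m : ℕ} {A B : Matrix (Fin n) (Fin m) ℂ} {R : List RegularBlock} {rt lf : List ℕ}

open Classical in
theorem HasKroneckerForm.rank_add_countP (h : HasKroneckerForm A B R rt lf) (μ : OnePoint ℂ) :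
    (pencilAt A B μ).rank + R.countP (fun b => b.eigenvalue = μ) =
      (R.map RegularBlock.size).sum + rt.sum + lf.sum :=
  (hasKroneckerForm_iff.1 h).rank_add_countP μ

open Classical in
theorem countP_eigenvalue_eq_zero {μ : OnePoint ℂ} :
    R.countP (fun b => b.eigenvalue = μ) = 0 ↔ ¬ IsBlockEigenvalue R μ := by
  simp [List.countP_eq_zero, IsBlockEigenvalue]

theorem exists_not_isBlockEigenvalue (R : List RegularBlock) :
    ∃ ζ : ℂ, ¬ IsBlockEigenvalue R ζ := by
  classical
  have hfin : {ζ : ℂ | IsBlockEigenvalue R ζ}.Finite := by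
    refine ((R.map RegularBlock.eigenvalue).toFinset.finite_toSet.preimage
      OnePoint.coe_injective.injOn).subset ?_
    rintro ζ ⟨b, hb, hbζ⟩
    simp only [Set.mem_preimage, Finset.mem_coe, List.mem_toFinset, List.mem_map]
    exact ⟨b, hb, hbζ⟩
  exact hfin.exists_notMem

theorem HasKroneckerForm.normalRank_eq (h : HasKroneckerForm A B R rt lf) :
    normalRank A B = (R.map RegularBlock.size).sum + rt.sum + lf.sum := by
  classical
  have hle : ∀ ζ : ℂ, (A - ζ • B).rank ≤ (R.map RegularBlock.size).sum + rt.sum + lf.sum :=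
    fun ζ => (Nat.le_add_right _ _).trans (h.rank_add_countP ζ).le
  apply le_antisymm (ciSup_le hle)
  obtain ⟨ζ, hζ⟩ := exists_not_isBlockEigenvalue R
  rw [← h.rank_add_countP ζ, countP_eigenvalue_eq_zero.2 hζ]
  exact le_ciSup (f := fun ζ : ℂ => (A - ζ • B).rank) ⟨_, Set.forall_mem_range.2 hle⟩ ζ

theorem HasKroneckerForm.isEigenvalue_iff (h : HasKroneckerForm A B R rt lf) (μ : OnePoint ℂ) :
    IsEigenvalue A B μ ↔ IsBlockEigenvalue R μ := by
  classical
  have h1 := h.rank_add_countP μ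
  have h2 := countP_eigenvalue_eq_zero (R := R) (μ := μ)
  unfold IsEigenvalue
  rw [h.normalRank_eq]
  by_cases h3 : IsBlockEigenvalue R μ
  · simp only [h3, not_true_eq_false, iff_false, iff_true] at h2 ⊢
    omega
  · simp only [h3, not_false_eq_true, iff_true, iff_false] at h2 ⊢
    omega

end Eigenvalues

/-! ### Transposition exchanges left and right singular blocks. -/

section Transpose

theorem StrictEquiv.blockDiagonal' {τ : Type*} [Fintype τ] [DecidableEq τ] {m n m' n' : τ → Type*}
    [∀ i, Fintype (m i)] [∀ i, Fintype (n i)] [∀ i, DecidableEq (m i)] [∀ i, DecidableEq (n i)]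
    [∀ i, Fintype (m' i)] [∀ i, Fintype (n' i)] [∀ i, DecidableEq (m' i)]
    [∀ i, DecidableEq (n' i)] {E F : ∀ i, Matrix (m i) (n i) ℂ}
    {E' F' : ∀ i, Matrix (m' i) (n' i) ℂ} (h : ∀ i, StrictEquiv (E i) (F i) (E' i) (F' i)) :
    StrictEquiv (Matrix.blockDiagonal' E) (Matrix.blockDiagonal' F)
      (Matrix.blockDiagonal' E') (Matrix.blockDiagonal' F') := by
  choose P P' Q Q' h1 h2 h3 h4 h5 h6 using h
  refine ⟨Matrix.blockDiagonal' P, Matrix.blockDiagonal' P', Matrix.blockDiagonal' Q,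
    Matrix.blockDiagonal' Q', ?_, ?_, ?_, ?_, ?_, ?_⟩
  · rw [← Matrix.blockDiagonal'_mul, ← Matrix.blockDiagonal'_one]
    exact congrArg _ (funext h1)
  · rw [← Matrix.blockDiagonal'_mul, ← Matrix.blockDiagonal'_one]
    exact congrArg _ (funext h2)
  · rw [← Matrix.blockDiagonal'_mul, ← Matrix.blockDiagonal'_one]
    exact congrArg _ (funext h3)
  · rw [← Matrix.blockDiagonal'_mul, ← Matrix.blockDiagonal'_one]
    exact congrArg _ (funext h4)
  · rw [← Matrix.blockDiagonal'_mul, ← Matrix.blockDiagonal'_mul]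
    exact congrArg _ (funext h5)
  · rw [← Matrix.blockDiagonal'_mul, ← Matrix.blockDiagonal'_mul]
    exact congrArg _ (funext h6)

/-- The block of the transposed pencil that corresponds to a Kronecker block. -/
def transposeBlock : KroneckerBlock → KroneckerBlock
  | .regular b => .regular b
  | .right j => .left j
  | .left j => .right j

/-- Reversing the order of the basis undoes the transposition. -/
theorem jordanBlock_transpose (ζ : ℂ) (d : ℕ) :
    (jordanBlock ζ d)ᵀ.submatrix Fin.revPerm Fin.revPerm = jordanBlock ζ d := by
  ext i j
  have h1 : (i : ℕ) + 1 = j ↔ d - (j + 1) + 1 = d - (i + 1) := by omega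
  by_cases h : i = j
  · simp [jordanBlock, h]
  · simp only [Matrix.submatrix_apply, Matrix.transpose_apply, jordanBlock, Matrix.of_apply,
      Fin.revPerm_apply, Fin.rev_inj, Ne.symm h, h, if_false, Fin.val_rev, h1]

theorem strictEquiv_transposeBlock (b : KroneckerBlock) :
    StrictEquiv b.matEᵀ b.matFᵀ (transposeBlock b).matE (transposeBlock b).matF := by
  cases b with
  | right j => exact StrictEquiv.refl _ _
  | left j => exact StrictEquiv.refl (rightE j) (rightF j)
  | regular b =>
    obtain ⟨ν, d, hd⟩ := b
    induction ν using OnePoint.rec with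
    | infty =>
      have := StrictEquiv.submatrix (1 : Matrix (Fin d) (Fin d) ℂ)ᵀ (jordanBlock 0 d)ᵀ
        Fin.revPerm Fin.revPerm
      rw [jordanBlock_transpose] at this
      simp only [Matrix.transpose_one, Matrix.submatrix_one_equiv] at this
      exact Matrix.transpose_one (n := Fin d) (α := ℂ) ▸ this
    | coe ν =>
      have := StrictEquiv.submatrix (jordanBlock ν d)ᵀ (1 : Matrix (Fin d) (Fin d) ℂ)ᵀ
        Fin.revPerm Fin.revPerm
      rw [jordanBlock_transpose] at this
      simp only [Matrix.transpose_one, Matrix.submatrix_one_equiv] at this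
      exact Matrix.transpose_one (n := Fin d) (α := ℂ) ▸ this

theorem HasBlocks.transpose {ι κ : Type*} [Fintype ι] [Fintype κ] [DecidableEq ι]
    [DecidableEq κ] {A B : Matrix ι κ ℂ} {S : Multiset KroneckerBlock} (h : HasBlocks A B S) :
    HasBlocks Aᵀ Bᵀ (S.map transposeBlock) := by
  obtain ⟨l, rfl, h⟩ := h
  rw [hasBlocks_iff (b := fun i => transposeBlock (l.get i))]
  · refine h.transpose.trans ?_
    unfold blocksE blocksF
    rw [Matrix.blockDiagonal'_transpose, Matrix.blockDiagonal'_transpose]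
    exact StrictEquiv.blockDiagonal' fun i => strictEquiv_transposeBlock _
  · rw [← univ_map_get l, Multiset.map_map]
    rfl

theorem HasKroneckerForm.transpose {n m : ℕ} {A B : Matrix (Fin n) (Fin m) ℂ}
    {R : List RegularBlock} {rt lf : List ℕ} (h : HasKroneckerForm A B R rt lf) :
    HasKroneckerForm Aᵀ Bᵀ R lf rt := by
  rw [hasKroneckerForm_iff] at h ⊢
  have h1 := h.transpose
  convert h1 using 1
  rw [Multiset.map_coe]
  simp only [kroneckerBlocks, List.map_append, List.map_map, ← Multiset.coe_add]
  rw [add_right_comm]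
  rfl

end Transpose

/-! ### Simple spectrum and separable characteristic polynomials. -/

section SimpleSpectrum

variable {ℓ : Type*} [Fintype ℓ] [DecidableEq ℓ]

/-- `C` is diagonalizable with pairwise distinct eigenvalues, none of which belongs to `s`. -/
def HasSimpleSpectrum (C : Matrix ℓ ℓ ℂ) (s : Finset ℂ) : Prop :=
  ∃ d : ℓ → ℂ, Function.Injective d ∧ (∀ i, d i ∉ s) ∧
    ∃ U U' : Matrix ℓ ℓ ℂ, U * U' = 1 ∧ U' * U = 1 ∧ C = U * diagonal d * U'

theorem HasSimpleSpectrum.smul {C : Matrix ℓ ℓ ℂ} {s : Finset ℂ} (h : HasSimpleSpectrum C s)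
    {c : ℂ} (hc : c ≠ 0) : HasSimpleSpectrum (c • C) (s.image (c * ·)) := by
  obtain ⟨d, hd, hds, U, U', h1, h2, rfl⟩ := h
  refine ⟨fun i => c * d i, fun i j hij => hd (mul_left_cancel₀ hc hij), fun i hi => ?_, U, U',
    h1, h2, ?_⟩
  · obtain ⟨a, ha, hac⟩ := Finset.mem_image.1 hi
    exact hds i (mul_left_cancel₀ hc hac ▸ ha)
  · rw [show diagonal (fun i => c * d i) = c • diagonal d from diagonal_smul c d]
    simp

theorem HasSimpleSpectrum.charpoly {C : Matrix ℓ ℓ ℂ} {s : Finset ℂ}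
    (h : HasSimpleSpectrum C s) :
    C.charpoly.Separable ∧ ∀ a ∈ s, C.charpoly.eval a ≠ 0 := by
  obtain ⟨d, hd, hds, U, U', h1, h2, rfl⟩ := h
  have hc : (U * diagonal d * U').charpoly = ∏ i, (Polynomial.X - Polynomial.C (d i)) := by
    rw [← Matrix.charpoly_diagonal]
    rw [← Matrix.inv_eq_right_inv h1]
    let u : (Matrix ℓ ℓ ℂ)ˣ := ⟨U, U', h1, h2⟩
    exact Matrix.charpoly_units_conj u (diagonal d)
  rw [hc]
  refine ⟨Polynomial.separable_prod_X_sub_C_iff.2 hd, fun a ha => ?_⟩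
  rw [Polynomial.eval_prod]
  refine Finset.prod_ne_zero_iff.2 fun i _ => ?_
  simp only [Polynomial.eval_sub, Polynomial.eval_X, Polynomial.eval_C]
  exact sub_ne_zero.2 fun h => hds i (h ▸ ha)

theorem hasSimpleSpectrum_of_charpoly {C : Matrix ℓ ℓ ℂ} {s : Finset ℂ}
    (h : C.charpoly.Separable) (hs : ∀ a ∈ s, C.charpoly.eval a ≠ 0) :
    HasSimpleSpectrum C s := by
  have hcard : Fintype.card C.charpoly.roots.toFinset = Fintype.card ℓ := by
    rw [Fintype.card_coe, Multiset.toFinset_card_of_nodup (Polynomial.nodup_roots h),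
      ← (IsAlgClosed.splits C.charpoly).natDegree_eq_card_roots, Matrix.charpoly_natDegree_eq_dim]
  let e : ℓ ≃ C.charpoly.roots.toFinset := (Fintype.equivOfCardEq hcard).symm
  let d : ℓ → ℂ := fun i => (e i : ℂ)
  have hd : Function.Injective d := Subtype.val_injective.comp e.injective
  have hroot : ∀ i, C.charpoly.eval (d i) = 0 := fun i =>
    (Polynomial.mem_roots'.1 (Multiset.mem_toFinset.1 (e i).2)).2
  have hev : ∀ i, ∃ v : ℓ → ℂ, Module.End.HasEigenvector (Matrix.toLin' C) (d i) v := by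
    intro i
    have : Module.End.HasEigenvalue (Matrix.toLin' C) (d i) := by
      rw [Module.End.hasEigenvalue_iff_isRoot_charpoly, Matrix.charpoly_toLin']
      exact hroot i
    exact this.exists_hasEigenvector
  choose v hv using hev
  have hli : LinearIndependent ℂ v :=
    Module.End.eigenvectors_linearIndependent' (Matrix.toLin' C) d hd v hv
  let U : Matrix ℓ ℓ ℂ := Matrix.of fun i j => v j i
  have hU : IsUnit U := Matrix.linearIndependent_cols_iff_isUnit.1 hli
  have hUd := (Matrix.isUnit_iff_isUnit_det U).1 hU
  have hCU : C * U = U * diagonal d := by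
    ext i j
    rw [Matrix.mul_diagonal]
    have := congrFun (hv j).apply_eq_smul i
    simp only [Matrix.toLin'_apply, Pi.smul_apply, smul_eq_mul] at this
    exact this.trans (mul_comm _ _)
  refine ⟨d, hd, fun i hi => hs _ hi (hroot i), U, U⁻¹, Matrix.mul_nonsing_inv _ hUd,
    Matrix.nonsing_inv_mul _ hUd, ?_⟩
  rw [← hCU, Matrix.mul_assoc, Matrix.mul_nonsing_inv _ hUd, Matrix.mul_one]

end SimpleSpectrum

/-! ### Simple spectrum as a polynomial nonvanishing condition. -/

section GenericPolynomial

variable {ν ω ℓ : Type*} [Fintype ν] [Fintype ω] [Fintype ℓ] [DecidableEq ν] [DecidableEq ω]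
  [DecidableEq ℓ]

/-- `X M` is nonsingular and the rows of `(X M)⁻¹ X N` selected by `s` form a matrix with simple
eigenvalues outside of `F`. -/
def IsGoodProjector (M : Matrix ν ω ℂ) (N : Matrix ν ℓ ℂ) (s : ℓ → ω) (F : Finset ℂ)
    (X : Matrix ω ν ℂ) : Prop :=
  (X * M).det ≠ 0 ∧ HasSimpleSpectrum (((X * M)⁻¹ * (X * N)).submatrix s id) F

/-- Replacing the inverse by the adjugate makes the matrix polynomial in X and only multiplies its
eigenvalues by det (X M). Goodness is then the nonvanishing of that determinant, of the resultant of
the characteristic polynomial with its derivative, and of its values at the rescaled points of F. A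
single good X shows that the product is not the zero polynomial. -/
theorem exists_polynomial_isGoodProjector (M : Matrix ν ω ℂ) (N : Matrix ν ℓ ℂ) (s : ℓ → ω)
    (F : Finset ℂ) (h : ∃ X, IsGoodProjector M N s F X) :
    ∃ p : MvPolynomial (ω × ν) ℂ, p ≠ 0 ∧
      ∀ X : Matrix ω ν ℂ, MvPolynomial.eval (fun ij => X ij.1 ij.2) p ≠ 0 →
        IsGoodProjector M N s F X := by
  let G : Matrix ω ν (MvPolynomial (ω × ν) ℂ) := Matrix.mvPolynomialX ω ν ℂ
  let M' : Matrix ν ω (MvPolynomial (ω × ν) ℂ) := M.map MvPolynomial.C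
  let N' : Matrix ν ℓ (MvPolynomial (ω × ν) ℂ) := N.map MvPolynomial.C
  let H : Matrix ω ω (MvPolynomial (ω × ν) ℂ) := G * M'
  let C : Matrix ℓ ℓ (MvPolynomial (ω × ν) ℂ) :=
    (H.adjugate * (G * N')).submatrix s id
  let k := Fintype.card ℓ
  let p : MvPolynomial (ω × ν) ℂ := H.det *
    Polynomial.resultant C.charpoly (Polynomial.derivative C.charpoly) k (k - 1) *
    ∏ a ∈ F, C.charpoly.eval (H.det * MvPolynomial.C a)
  let D : Matrix ω ν ℂ → Matrix ℓ ℓ ℂ := fun X =>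
    ((X * M).adjugate * (X * N)).submatrix s id
  have hp : ∀ X : Matrix ω ν ℂ, MvPolynomial.eval (fun ij => X ij.1 ij.2) p =
      (X * M).det * Polynomial.resultant (D X).charpoly (Polynomial.derivative (D X).charpoly) *
        ∏ a ∈ F, (D X).charpoly.eval ((X * M).det * a) := by
    intro X
    let φ : MvPolynomial (ω × ν) ℂ →+* ℂ := MvPolynomial.eval (fun ij => X ij.1 ij.2)
    have hG : G.map φ = X := by
      ext i j
      simp [G, φ, Matrix.mvPolynomialX_apply]
    have hMc : M'.map φ = M := by ext i j; simp [M', φ]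
    have hNc : N'.map φ = N := by ext i j; simp [N', φ]
    have hH : H.map φ = X * M := by rw [Matrix.map_mul, hG, hMc]
    have hdet : φ H.det = (X * M).det := by
      rw [← hH]
      exact RingHom.map_det φ H
    have hadj : H.adjugate.map φ = (X * M).adjugate := by
      rw [← hH]
      exact RingHom.map_adjugate φ H
    have hC : C.map φ = D X := by
      have : (H.adjugate * (G * N')).map φ = (X * M).adjugate * (X * N) := by
        rw [Matrix.map_mul, Matrix.map_mul, hadj, hG, hNc]
      exact congrArg (fun T => T.submatrix s id) this
    have hchar : C.charpoly.map φ = (D X).charpoly := by rw [← hC, Matrix.charpoly_map]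
    change φ p = _
    simp only [p, map_mul, map_prod]
    -- The formal degrees k and k - 1 are the true ones after every specialization: the
    -- characteristic polynomial is monic and the characteristic is 0. Hence the resultant
    -- specializes.
    rw [hdet, ← Polynomial.resultant_map_map, ← Polynomial.derivative_map, hchar,
      Polynomial.natDegree_derivative, Matrix.charpoly_natDegree_eq_dim]
    congr 1
    refine Finset.prod_congr rfl fun a _ => ?_
    have ha : (X * M).det * a = φ (H.det * MvPolynomial.C a) := by
      rw [map_mul, hdet, MvPolynomial.eval_C]
    rw [← hchar, Polynomial.eval_map, ha, Polynomial.eval₂_at_apply]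
  have hsmul : ∀ X : Matrix ω ν ℂ, (X * M).det ≠ 0 →
      (X * M).det • ((X * M)⁻¹ * (X * N)).submatrix s id = D X := by
    intro X hX
    have : (X * M).adjugate = (X * M).det • (X * M)⁻¹ := by
      rw [Matrix.inv_def, Ring.inverse_eq_inv', smul_smul, mul_inv_cancel₀ hX, one_smul]
    simp only [D, this, Matrix.smul_mul]
    rfl
  refine ⟨p, ?_, fun X hX => ?_⟩
  · obtain ⟨X, hX, hXs⟩ := h
    intro h0
    have h1 := hp X
    rw [h0, map_zero] at h1
    obtain ⟨h2, h3⟩ := (hXs.smul hX).charpoly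
    rw [hsmul X hX] at h2 h3
    refine mul_ne_zero (mul_ne_zero hX ?_) (Finset.prod_ne_zero_iff.2 fun a ha => ?_) h1.symm
    · rw [Ne, Polynomial.resultant_eq_zero_iff]
      exact fun h4 => h4.2 h2
    · exact h3 _ (Finset.mem_image_of_mem _ ha)
  · rw [hp X] at hX
    have h1 := left_ne_zero_of_mul (left_ne_zero_of_mul hX)
    have h2 := right_ne_zero_of_mul (left_ne_zero_of_mul hX)
    have h3 := Finset.prod_ne_zero_iff.1 (right_ne_zero_of_mul hX)
    refine ⟨h1, ?_⟩
    have h4 : (D X).charpoly.Separable := by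
      by_contra h5
      exact h2 (Polynomial.resultant_eq_zero_iff.2
        ⟨Or.inl (Matrix.charpoly_monic _).ne_zero, h5⟩)
    have h5 : HasSimpleSpectrum (D X) (F.image ((X * M).det * ·)) :=
      hasSimpleSpectrum_of_charpoly h4 fun a ha => by
        obtain ⟨b, hb, rfl⟩ := Finset.mem_image.1 ha
        exact h3 b hb
    have h6 := h5.smul (inv_ne_zero h1)
    rw [← hsmul X h1, smul_smul, inv_mul_cancel₀ h1, one_smul, Finset.image_image] at h6
    convert h6
    rw [show ((fun x => (X * M).det⁻¹ * x) ∘ fun x => (X * M).det * x) = id by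
      funext x; simp [h1], Finset.image_id]

end GenericPolynomial

/-! ### Decoupling a block triangular pencil. -/

section Sylvester

variable {ρ σ ℓ : Type*} [Fintype ρ] [Fintype σ] [Fintype ℓ] [DecidableEq ρ] [DecidableEq σ]
  [DecidableEq ℓ]

/-- The off-diagonal block is removed by a solution Z of the Sylvester equation E Z - F Z diag(d) =
-K U. Column i of it reads (E - d_i F) z_i = -(K U)_i, which is solvable by surjectivity. -/
theorem strictEquiv_fromBlocks_of_surjective {E F : Matrix ρ σ ℂ} {K : Matrix ρ ℓ ℂ}
    {C U U' : Matrix ℓ ℓ ℂ} {d : ℓ → ℂ} (hU : U * U' = 1) (hU' : U' * U = 1)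
    (hC : C = U * diagonal d * U') (hd : ∀ i, Function.Surjective (E - d i • F).mulVecLin) :
    StrictEquiv (fromBlocks E K 0 C) (fromBlocks F 0 0 1) (fromBlocks E 0 0 (diagonal d))
      (fromBlocks F 0 0 1) := by
  choose z hz using fun i => hd i (-(K * U).col i)
  let Z : Matrix σ ℓ ℂ := Matrix.of fun a i => z i a
  have hZ : E * Z - F * Z * diagonal d = -(K * U) := by
    ext a i
    have := congrFun (hz i) a
    rw [Matrix.mulVecLin_apply, Matrix.sub_mulVec, Matrix.smul_mulVec] at this
    rw [Matrix.sub_apply, Matrix.mul_diagonal, mul_comm]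
    exact this
  have hCU : U' * C * U = diagonal d := by
    rw [hC]
    calc U' * (U * diagonal d * U') * U = (U' * U) * diagonal d * (U' * U) := by
          simp only [Matrix.mul_assoc]
      _ = diagonal d := by simp [hU']
  have hTU : (F * Z * U') * C * U = F * Z * diagonal d := by
    rw [← hCU]; simp only [Matrix.mul_assoc]
  refine ⟨fromBlocks 1 (-(F * Z * U')) 0 U', fromBlocks 1 (F * Z) 0 U, fromBlocks 1 Z 0 U,
    fromBlocks 1 (-(Z * U')) 0 U', ?_, ?_, ?_, ?_, ?_, ?_⟩
  · rw [fromBlocks_multiply]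
    simp [Matrix.mul_assoc, hU']
  · rw [fromBlocks_multiply]
    simp [hU]
  · rw [fromBlocks_multiply]
    simp [hU]
  · rw [fromBlocks_multiply]
    simp [Matrix.mul_assoc, hU']
  · rw [fromBlocks_multiply, fromBlocks_multiply]
    simp only [Matrix.one_mul, Matrix.mul_one, Matrix.mul_zero, Matrix.zero_mul, add_zero, zero_add,
      hCU, Matrix.add_mul, Matrix.neg_mul, hTU]
    congr 1
    rw [sub_eq_iff_eq_add.1 hZ]
    abel
  · rw [fromBlocks_multiply, fromBlocks_multiply]
    simp [Matrix.mul_assoc, hU']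

/-- The simple block with eigenvalue `ζ`. -/
def simpleBlock (ζ : ℂ) : RegularBlock := ⟨(ζ : OnePoint ℂ), 1, one_pos⟩

theorem hasBlocks_diagonal (d : ℓ → ℂ) :
    HasBlocks (diagonal d) (1 : Matrix ℓ ℓ ℂ)
      (Finset.univ.val.map fun i => KroneckerBlock.regular (simpleBlock (d i))) := by
  rw [hasBlocks_iff rfl]
  have key := StrictEquiv.submatrix (diagonal d) (1 : Matrix ℓ ℓ ℂ)
    (Equiv.sigmaUnique ℓ fun _ => Fin 1) (Equiv.sigmaUnique ℓ fun _ => Fin 1)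
  change StrictEquiv (diagonal d) (1 : Matrix ℓ ℓ ℂ)
    (Matrix.blockDiagonal' fun i => jordanBlock (d i) 1)
    (Matrix.blockDiagonal' fun _ => (1 : Matrix (Fin 1) (Fin 1) ℂ))
  convert key using 1
  · ext ⟨i, r⟩ ⟨j, c⟩
    by_cases h : i = j
    · subst h
      simp [jordanBlock, Subsingleton.elim r c]
    · simp [Matrix.blockDiagonal'_apply_ne, h]
  · ext ⟨i, r⟩ ⟨j, c⟩
    by_cases h : i = j
    · subst h
      simp [Subsingleton.elim r c]
    · simp [Matrix.blockDiagonal'_apply_ne, h]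

end Sylvester

/-! ### Left multiplication by a good matrix. -/

section Projection

variable {ν κ ω ρ σ η ℓ : Type*} [Fintype ν] [Fintype κ] [Fintype ω] [Fintype ρ] [Fintype σ]
  [Fintype η] [Fintype ℓ] [DecidableEq ν] [DecidableEq κ] [DecidableEq ω] [DecidableEq ρ]
  [DecidableEq σ] [DecidableEq η] [DecidableEq ℓ]

theorem fromBlocks_of_mul_eq_one {Y : Matrix (ρ ⊕ ℓ) (ρ ⊕ η) ℂ} {LF : Matrix η ℓ ℂ}
    (h : Y * fromBlocks (1 : Matrix ρ ρ ℂ) 0 0 LF = 1) :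
    Y = fromBlocks 1 Y.toBlocks₁₂ 0 Y.toBlocks₂₂ ∧ Y.toBlocks₁₂ * LF = 0 ∧
      Y.toBlocks₂₂ * LF = 1 := by
  have hY := fromBlocks_toBlocks Y
  rw [← hY, fromBlocks_multiply, ← fromBlocks_one, fromBlocks_inj] at h
  simp only [Matrix.mul_one, Matrix.mul_zero, add_zero, zero_add] at h
  obtain ⟨h1, h2, h3, h4⟩ := h
  refine ⟨?_, h2, h4⟩
  rw [← h1, ← h3, hY]

theorem mul_submatrix_submatrix_symm (X : Matrix ω ν ℂ) (M : Matrix ν ρ ℂ) (e : ρ ≃ σ) :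
    (X * M.submatrix id e.symm).submatrix id e = X * M := by
  ext i j
  simp [Matrix.mul_apply]

/-- Row operations by H⁻¹ bring X P' to the form [1 Y₁₂; 0 Y₂₂] with Y₁₂ LF = 0 and Y₂₂ LF = 1. The
pencil is then block triangular with lower diagonal block Y₂₂ LE - λ, whose spectrum is simple and
avoids F, and the Sylvester equation decouples it. -/
theorem strictEquiv_mul_of_isGoodProjector {A B : Matrix ν κ ℂ} {SE SF : Matrix ρ σ ℂ}
    {LE LF : Matrix η ℓ ℂ} {P : Matrix (ρ ⊕ η) ν ℂ} {P' : Matrix ν (ρ ⊕ η) ℂ}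
    {Q : Matrix κ (σ ⊕ ℓ) ℂ} {Q' : Matrix (σ ⊕ ℓ) κ ℂ} (hP : P' * P = 1)
    (hQ : Q * Q' = 1) (hQ' : Q' * Q = 1) (hA : P * A * Q = fromBlocks SE 0 0 LE)
    (hB : P * B * Q = fromBlocks SF 0 0 LF) (e : ρ ⊕ ℓ ≃ ω) {F : Finset ℂ}
    (hS : ∀ ζ, ζ ∉ F → Function.Surjective (SE - ζ • SF).mulVecLin) {X : Matrix ω ν ℂ}
    (hX : IsGoodProjector ((P' * fromBlocks (1 : Matrix ρ ρ ℂ) 0 0 LF).submatrix id e.symm) (P' * fromRows (0 : Matrix ρ ℓ ℂ) LE)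
      (e ∘ Sum.inr) F X) :
    ∃ d : ℓ → ℂ, Function.Injective d ∧ (∀ i, d i ∉ F) ∧
      StrictEquiv (X * A) (X * B) (fromBlocks SE 0 0 (diagonal d)) (fromBlocks SF 0 0 1) := by
  obtain ⟨hdet, d, hd, hdF, U, U', hU, hU', hC⟩ := hX
  refine ⟨d, hd, hdF, ?_⟩
  set H := X * (P' * fromBlocks (1 : Matrix ρ ρ ℂ) 0 0 LF).submatrix id e.symm with hH
  have hHu : IsUnit H.det := isUnit_iff_ne_zero.2 hdet
  let Y : Matrix (ρ ⊕ ℓ) (ρ ⊕ η) ℂ := (H⁻¹ * X * P').submatrix e id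
  have hY : Y * fromBlocks (1 : Matrix ρ ρ ℂ) 0 0 LF = 1 := by
    have h1 : H.submatrix id e = X * (P' * fromBlocks (1 : Matrix ρ ρ ℂ) 0 0 LF) := by
      rw [hH, mul_submatrix_submatrix_symm]
    calc Y * fromBlocks (1 : Matrix ρ ρ ℂ) 0 0 LF
        = (H⁻¹ * (X * (P' * fromBlocks (1 : Matrix ρ ρ ℂ) 0 0 LF))).submatrix e id := by
          simp only [← Matrix.mul_assoc]
          rfl
      _ = (H⁻¹ * H).submatrix e e := by
          rw [← h1]
          rfl
      _ = 1 := by rw [Matrix.nonsing_inv_mul _ hHu, Matrix.submatrix_one_equiv]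
  obtain ⟨h1, h2, h3⟩ := fromBlocks_of_mul_eq_one hY
  have h4 : (H⁻¹ * (X * (P' * fromRows (0 : Matrix ρ ℓ ℂ) LE))).submatrix (e ∘ Sum.inr) id =
      Y.toBlocks₂₂ * LE := by
    have h5 : Y * fromRows (0 : Matrix ρ ℓ ℂ) LE = fromRows (Y.toBlocks₁₂ * LE) (Y.toBlocks₂₂ * LE) := by
      rw [h1, fromBlocks_mul_fromRows]
      simp
    have h6 : (H⁻¹ * (X * (P' * fromRows (0 : Matrix ρ ℓ ℂ) LE))).submatrix e id = Y * fromRows (0 : Matrix ρ ℓ ℂ) LE := by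
      simp only [← Matrix.mul_assoc]
      rfl
    ext i j
    have := congrFun (congrFun (h6.trans h5) (Sum.inr i)) j
    simpa using this
  rw [h4] at hC
  have h7 : StrictEquiv (X * A) (X * B) (Y * fromBlocks SE 0 0 LE) (Y * fromBlocks SF 0 0 LF) := by
    have key : ∀ T : Matrix ν κ ℂ,
        H⁻¹.submatrix e id * (X * T) * Q = Y * (P * T * Q) := by
      intro T
      calc H⁻¹.submatrix e id * (X * T) * Q = (H⁻¹ * X).submatrix e id * (P' * P) * T * Q := by
            rw [hP, Matrix.mul_one]
            simp only [← Matrix.mul_assoc]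
            rfl
        _ = Y * (P * T * Q) := by
            simp only [← Matrix.mul_assoc]
            rfl
    refine ⟨H⁻¹.submatrix e id, H.submatrix id e, Q, Q', ?_, ?_, hQ, hQ', ?_, ?_⟩
    · rw [← Matrix.submatrix_mul _ _ _ _ _ Function.bijective_id, Matrix.nonsing_inv_mul _ hHu,
        Matrix.submatrix_one_equiv]
    · rw [Matrix.submatrix_mul_equiv, Matrix.mul_nonsing_inv _ hHu, Matrix.submatrix_id_id]
    · rw [key, hA]
    · rw [key, hB]
  refine h7.trans ?_
  have h8 : Y * fromBlocks SE 0 0 LE =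
      fromBlocks SE (Y.toBlocks₁₂ * LE) 0 (Y.toBlocks₂₂ * LE) := by
    rw [h1, fromBlocks_multiply]
    simp
  have h9 : Y * fromBlocks SF 0 0 LF = fromBlocks SF 0 0 1 := by
    rw [h1, fromBlocks_multiply]
    simp [h2, h3]
  rw [h8, h9]
  exact strictEquiv_fromBlocks_of_surjective hU hU' hC fun i => hS _ (hdF i)

end Projection

/-! ### A Vandermonde example of a good matrix. -/

section LeftBlocks

variable {τ : Type*} [Fintype τ] [DecidableEq τ]

/-- The constant coefficient of the direct sum of the pencils `L_j(λ)ᵀ`. -/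
def leftE (j : τ → ℕ) : Matrix (Σ i, Fin (j i + 1)) (Σ i, Fin (j i)) ℂ :=
  Matrix.blockDiagonal' fun i => (rightE (j i))ᵀ

/-- The coefficient of `-λ` of the direct sum of the pencils `L_j(λ)ᵀ`. -/
def leftF (j : τ → ℕ) : Matrix (Σ i, Fin (j i + 1)) (Σ i, Fin (j i)) ℂ :=
  Matrix.blockDiagonal' fun i => (rightF (j i))ᵀ

/-- The row (1, d, …, d^j) annihilates L_j(d)ᵀ. Such rows for distinct d, taken block by block, form
T, and V consists of Vandermonde blocks. -/
theorem exists_mul_left_eq_diagonal_mul (j : τ → ℕ) {d : (Σ i, Fin (j i)) → ℂ}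
    (hd : Function.Injective d) :
    ∃ (T : Matrix (Σ i, Fin (j i)) (Σ i, Fin (j i + 1)) ℂ)
      (V : Matrix (Σ i, Fin (j i)) (Σ i, Fin (j i)) ℂ), V.det ≠ 0 ∧
      T * leftF j = V ∧ T * leftE j = diagonal d * V := by
  let v : ∀ i, Matrix (Fin (j i)) (Fin (j i)) ℂ := fun i =>
    Matrix.vandermonde fun s => d ⟨i, s⟩
  have hv : ∀ i, IsUnit (v i).det := fun i => isUnit_iff_ne_zero.2
    (Matrix.det_vandermonde_ne_zero_iff.2 fun s t hst => by simpa using hd hst)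
  refine ⟨Matrix.blockDiagonal' fun i => Matrix.of fun (s : Fin (j i)) (t : Fin (j i + 1)) =>
    d ⟨i, s⟩ ^ (t : ℕ), Matrix.blockDiagonal' v, ?_, ?_, ?_⟩
  · have h1 : Matrix.blockDiagonal' v * Matrix.blockDiagonal' (fun i => (v i)⁻¹) = 1 := by
      rw [← Matrix.blockDiagonal'_mul, ← Matrix.blockDiagonal'_one]
      exact congrArg _ (funext fun i => Matrix.mul_nonsing_inv _ (hv i))
    intro h0
    have := congrArg Matrix.det h1
    simp [h0] at this
  · rw [leftF, ← Matrix.blockDiagonal'_mul]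
    congr 1
    funext i
    ext s t
    simp [Matrix.mul_apply, rightF, v, Matrix.vandermonde_apply]
  · have h2 : diagonal d = Matrix.blockDiagonal' fun i => diagonal fun s => d ⟨i, s⟩ := by
      ext ⟨i, s⟩ ⟨i', s'⟩
      by_cases h : i = i'
      · subst h
        simp [Matrix.diagonal_apply]
      · simp [Matrix.blockDiagonal'_apply_ne, h]
    rw [h2, leftE, ← Matrix.blockDiagonal'_mul, ← Matrix.blockDiagonal'_mul]
    congr 1
    funext i
    ext s t
    rw [Matrix.diagonal_mul]
    simp [Matrix.mul_apply, rightE, v, Matrix.vandermonde_apply, pow_succ, mul_comm]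

theorem exists_injective_notMem (ℓ : Type*) [Fintype ℓ] (F : Finset ℂ) :
    ∃ d : ℓ → ℂ, Function.Injective d ∧ ∀ i, d i ∉ F := by
  have : Infinite ((F : Set ℂ)ᶜ : Set ℂ) := F.finite_toSet.infinite_compl.to_subtype
  let f := Infinite.natEmbedding ((F : Set ℂ)ᶜ : Set ℂ)
  let e := Fintype.equivFin ℓ
  exact ⟨fun i => f (e i), fun i i' h => e.injective (Fin.ext (f.injective (Subtype.ext h))),
    fun i => (f (e i)).2⟩

theorem submatrix_mul_mul_mul_cancel {μ ν ω ω' α : Type*} [Fintype μ] [Fintype ν]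
    [DecidableEq μ] {P : Matrix μ ν ℂ} {P' : Matrix ν μ ℂ} (hP : P * P' = 1) (Y : Matrix ω μ ℂ)
    (f : ω' → ω) (M : Matrix μ α ℂ) :
    (Y * P).submatrix f id * (P' * M) = (Y * M).submatrix f id := by
  calc (Y * P).submatrix f id * (P' * M) = (Y * (P * P') * M).submatrix f id := by
        simp only [← Matrix.mul_assoc]
        rfl
    _ = (Y * M).submatrix f id := by rw [hP, Matrix.mul_one]

/-- For X built from diag(1, T), the matrix whose spectrum matters is V⁻¹ diag(d) V, with d
injective and chosen outside F. -/
theorem exists_isGoodProjector {ν ω ρ : Type*} [Fintype ν] [Fintype ω] [Fintype ρ]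
    [DecidableEq ν] [DecidableEq ω] [DecidableEq ρ] (j : τ → ℕ)
    {P : Matrix (ρ ⊕ Σ i, Fin (j i + 1)) ν ℂ} {P' : Matrix ν (ρ ⊕ Σ i, Fin (j i + 1)) ℂ}
    (hP : P * P' = 1) (e : (ρ ⊕ Σ i, Fin (j i)) ≃ ω) (F : Finset ℂ) :
    ∃ X, IsGoodProjector ((P' * fromBlocks (1 : Matrix ρ ρ ℂ) 0 0 (leftF j)).submatrix id e.symm)
      (P' * fromRows (0 : Matrix ρ (Σ i, Fin (j i)) ℂ) (leftE j)) (e ∘ Sum.inr) F X := by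
  obtain ⟨d, hd, hdF⟩ := exists_injective_notMem (Σ i, Fin (j i)) F
  obtain ⟨T, V, hV, hTF, hTE⟩ := exists_mul_left_eq_diagonal_mul j hd
  have hVu : IsUnit V.det := isUnit_iff_ne_zero.2 hV
  let Y : Matrix (ρ ⊕ Σ i, Fin (j i)) (ρ ⊕ Σ i, Fin (j i + 1)) ℂ := fromBlocks 1 0 0 T
  have hH : (Y * P).submatrix e.symm id * (P' * fromBlocks (1 : Matrix ρ ρ ℂ) 0 0 (leftF j)).submatrix id e.symm =
      (fromBlocks (1 : Matrix ρ ρ ℂ) 0 0 V).submatrix e.symm e.symm := by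
    have h1 := submatrix_mul_mul_mul_cancel hP Y e.symm (fromBlocks (1 : Matrix ρ ρ ℂ) 0 0 (leftF j))
    have h2 : Y * fromBlocks (1 : Matrix ρ ρ ℂ) 0 0 (leftF j) = fromBlocks (1 : Matrix ρ ρ ℂ) 0 0 V := by
      rw [fromBlocks_multiply]
      simp [hTF]
    rw [h2] at h1
    exact congrArg (fun M => M.submatrix id e.symm) h1
  have hN : Y * fromRows (0 : Matrix ρ (Σ i, Fin (j i)) ℂ) (leftE j) = fromRows (0 : Matrix ρ (Σ i, Fin (j i)) ℂ) (diagonal d * V) := by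
    rw [fromBlocks_mul_fromRows]
    simp [hTE]
  refine ⟨(Y * P).submatrix e.symm id, ?_, d, hd, hdF, V⁻¹, V, Matrix.nonsing_inv_mul _ hVu,
    Matrix.mul_nonsing_inv _ hVu, ?_⟩
  · rw [hH, Matrix.det_submatrix_equiv_self, Matrix.det_fromBlocks_zero₂₁]
    simpa using hV
  · have h3 : ((fromBlocks (1 : Matrix ρ ρ ℂ) 0 0 V).submatrix e.symm e.symm)⁻¹ =
        (fromBlocks (1 : Matrix ρ ρ ℂ) 0 0 V⁻¹).submatrix e.symm e.symm := by
      apply Matrix.inv_eq_left_inv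
      rw [Matrix.submatrix_mul_equiv, fromBlocks_multiply]
      simp [Matrix.nonsing_inv_mul _ hVu]
    rw [hH, submatrix_mul_mul_mul_cancel hP, hN, h3, Matrix.submatrix_mul_equiv, fromBlocks_mul_fromRows]
    ext a b
    simp [Matrix.mul_assoc]

end LeftBlocks

/-! ### Generic left multiplication in terms of the Kronecker form. -/

section LeftProjection

theorem univ_map_sumElim {τ τ' α : Type*} [Fintype τ] [Fintype τ'] (b : τ → α) (b' : τ' → α) :
    Finset.univ.val.map (Sum.elim b b') = Finset.univ.val.map b + Finset.univ.val.map b' := by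
  rw [← Finset.univ_disjSum_univ, Finset.val_disjSum, Multiset.disjSum, Multiset.map_add,
    Multiset.map_map, Multiset.map_map]
  rfl

theorem sum_get {α : Type*} (l : List α) (f : α → ℕ) : ∑ i, f (l.get i) = (l.map f).sum := by
  rw [← Multiset.sum_coe, ← Multiset.map_coe, ← univ_map_get l, Multiset.map_map]
  rfl

theorem rank_pencilValue_blocks {R : List RegularBlock} {rt : List ℕ} {ζ : ℂ}
    (hζ : ¬ IsBlockEigenvalue R ζ) :
    let l := R.map KroneckerBlock.regular ++ rt.map KroneckerBlock.right
    (blocksE l.get - ζ • blocksF l.get).rank = Fintype.card (Σ i, Fin (l.get i).rows) := by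
  intro l
  have h1 := (hasBlocks_blocks l.get).rank_pencilValue ζ
  rw [pencilValue_coe] at h1
  rw [h1, Fintype.card_sigma, Multiset.map_map]
  refine Finset.sum_congr rfl fun i _ => ?_
  rw [Fintype.card_fin]
  have hi : l.get i ∈ l := List.get_mem l i
  simp only [Function.comp_apply]
  generalize l.get i = b at hi
  simp only [l, List.mem_append, List.mem_map] at hi
  rcases hi with ⟨b, hb, rfl⟩ | ⟨j, -, rfl⟩
  · exact if_neg fun h => hζ ⟨b, hb, h⟩
  · rfl

variable {n m : ℕ} {A B : Matrix (Fin n) (Fin m) ℂ} {R : List RegularBlock} {rt lf : List ℕ}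

/-- Multiplying a pencil of normal rank `r` from the left by a generic matrix with `r` rows removes
its left singular blocks, adds simple eigenvalues outside of a given finite set, and changes nothing
else. -/
theorem HasKroneckerForm.exists_polynomial_mul_left (h : HasKroneckerForm A B R rt lf) {r : ℕ}
    (hr : normalRank A B = r) :
    ∃ p : MvPolynomial (Fin r × Fin n) ℂ, p ≠ 0 ∧
      ∀ X : Matrix (Fin r) (Fin n) ℂ, MvPolynomial.eval (fun ij => X ij.1 ij.2) p ≠ 0 →
        ∃ ds : List ℂ, ds.Nodup ∧ (∀ c ∈ ds, ¬ IsBlockEigenvalue R c) ∧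
          HasKroneckerForm (X * A) (X * B) (R ++ ds.map simpleBlock) rt [] := by
  classical
  let l := R.map KroneckerBlock.regular ++ rt.map KroneckerBlock.right
  let j : Fin lf.length → ℕ := lf.get
  let F : Finset ℂ := (R.map RegularBlock.eigenvalue).toFinset.preimage (fun ζ : ℂ => (ζ : OnePoint ℂ))
    OnePoint.coe_injective.injOn
  have hF : ∀ ζ, ζ ∉ F → ¬ IsBlockEigenvalue R ζ := by
    rintro ζ hζ ⟨b, hb, hbζ⟩
    refine hζ (Finset.mem_preimage.2 (List.mem_toFinset.2 (List.mem_map.2 ⟨b, hb, hbζ⟩)))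
  have hmap : Finset.univ.val.map (Sum.elim l.get fun i => KroneckerBlock.left (j i)) =
      (kroneckerBlocks R rt lf : Multiset KroneckerBlock) := by
    rw [univ_map_sumElim, univ_map_get]
    have : Finset.univ.val.map (fun i => KroneckerBlock.left (j i)) =
        (lf.map KroneckerBlock.left : Multiset KroneckerBlock) := by
      rw [← Multiset.map_coe, ← univ_map_get lf, Multiset.map_map]
      rfl
    rw [this]
    rfl
  have hs : StrictEquiv A B (fromBlocks (blocksE l.get) 0 0 (leftE j))
      (fromBlocks (blocksF l.get) 0 0 (leftF j)) :=
    ((hasBlocks_iff hmap).1 (hasKroneckerForm_iff.1 h)).trans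
      (strictEquiv_blocks_sumElim l.get fun i => KroneckerBlock.left (j i)).symm
  -- The normal rank r counts the rows of the regular and right blocks and the columns of the left
  -- blocks; this makes X times the normalizing matrix square.
  have hcard : Fintype.card ((Σ i, Fin (l.get i).rows) ⊕ Σ i, Fin (j i)) = Fintype.card (Fin r) := by
    rw [Fintype.card_sum, Fintype.card_sigma, Fintype.card_sigma]
    simp only [Fintype.card_fin]
    rw [sum_get l KroneckerBlock.rows, sum_get lf fun i => i, ← hr, h.normalRank_eq]
    simp only [l, List.map_append, List.map_map, List.sum_append, List.map_id']
    have h2 : (rt.map (KroneckerBlock.rows ∘ KroneckerBlock.right)).sum = rt.sum :=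
      congrArg List.sum (List.map_id' rt)
    rw [h2]
    rfl
  let e := Fintype.equivOfCardEq hcard
  obtain ⟨P, P', Q, Q', h1, h2, h3, h4, hA, hB⟩ := hs
  obtain ⟨p, hp, hpX⟩ := exists_polynomial_isGoodProjector _ _ _ _ (exists_isGoodProjector j h1 e F)
  refine ⟨p, hp, fun X hX => ?_⟩
  obtain ⟨d, hd, hdF, hse⟩ := strictEquiv_mul_of_isGoodProjector h2 h3 h4 hA hB e
    (fun ζ hζ => mulVec_surjective_of_rank (rank_pencilValue_blocks (hF ζ hζ))) (hpX X hX)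
  refine ⟨Finset.univ.toList.map d, (Finset.nodup_toList _).map hd, ?_, ?_⟩
  · intro c hc
    obtain ⟨i, -, rfl⟩ := List.mem_map.1 hc
    exact hF _ (hdF i)
  · rw [hasKroneckerForm_iff]
    have h5 := HasBlocks.of_strictEquiv hse
      ((hasBlocks_blocks l.get).fromBlocks (hasBlocks_diagonal d))
    convert h5 using 1
    have h6 : Finset.univ.val.map (fun i => KroneckerBlock.regular (simpleBlock (d i))) =
        (((Finset.univ.toList.map d).map simpleBlock).map KroneckerBlock.regular :
          Multiset KroneckerBlock) := by
      rw [List.map_map, List.map_map, ← Multiset.map_coe, Finset.coe_toList]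
      rfl
    rw [h6, univ_map_get]
    simp only [kroneckerBlocks, l, List.map_append, List.map_nil, List.append_nil,
      ← Multiset.coe_add]
    exact add_right_comm _ _ _

end LeftProjection

/-! ### From complex polynomial conditions to generic sets. -/

section Genericity

open MvPolynomial in
theorem exists_real_imag_polynomials {n p : ℕ} {τ : Type*}
    (g : Matrix (Fin n) (Fin p) ℂ → τ → ℂ)
    (hg : ∀ t, ∃ a b : MvPolynomial ((Fin n × Fin p) ⊕ (Fin n × Fin p)) ℝ, ∀ M,
      g M t = (eval (realCoords M) a : ℂ) + eval (realCoords M) b * Complex.I)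
    (q : MvPolynomial τ ℂ) :
    ∃ a b : MvPolynomial ((Fin n × Fin p) ⊕ (Fin n × Fin p)) ℝ, ∀ M,
      eval (g M) q = (eval (realCoords M) a : ℂ) + eval (realCoords M) b * Complex.I := by
  induction q using MvPolynomial.induction_on with
  | C c =>
    refine ⟨C c.re, C c.im, fun M => ?_⟩
    simp only [eval_C]
    exact (Complex.re_add_im c).symm
  | add q q' h h' =>
    obtain ⟨a, b, h⟩ := h
    obtain ⟨a', b', h'⟩ := h'
    refine ⟨a + a', b + b', fun M => ?_⟩
    simp only [map_add, h, h', Complex.ofReal_add]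
    ring
  | mul_X q t h =>
    obtain ⟨a, b, h⟩ := h
    obtain ⟨a', b', h'⟩ := hg t
    refine ⟨a * a' - b * b', a * b' + b * a', fun M => ?_⟩
    simp only [map_mul, map_add, map_sub, h, eval_X, h', Complex.ofReal_add, Complex.ofReal_sub,
      Complex.ofReal_mul]
    linear_combination (eval (realCoords M) b : ℂ) * eval (realCoords M) b' * Complex.I_sq

/-- The zero set of a complex polynomial is cut out by its real and imaginary parts. Only these need
be polynomial in the real coordinates of M, which admits conjugation in g. -/
theorem isGeneric_of_polynomial {n p : ℕ} {τ : Type*} (g : Matrix (Fin n) (Fin p) ℂ → τ → ℂ)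
    (hg : ∀ t, ∃ a b : MvPolynomial ((Fin n × Fin p) ⊕ (Fin n × Fin p)) ℝ, ∀ M,
      g M t = (MvPolynomial.eval (realCoords M) a : ℂ) +
        MvPolynomial.eval (realCoords M) b * Complex.I)
    (hsurj : Function.Surjective g) {q : MvPolynomial τ ℂ} (hq : q ≠ 0) :
    IsGeneric {M | MvPolynomial.eval (g M) q ≠ 0} := by
  classical
  obtain ⟨a, b, h⟩ := exists_real_imag_polynomials g hg q
  refine ⟨{x | ∀ p ∈ ({a, b} : Finset _), MvPolynomial.eval x p = 0}, ⟨{a, b}, rfl⟩, ?_, ?_⟩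
  · intro huniv
    obtain ⟨t, ht⟩ : ∃ t, MvPolynomial.eval t q ≠ 0 := by
      by_contra hno
      push Not at hno
      exact hq (MvPolynomial.funext fun t => by rw [hno t, map_zero])
    obtain ⟨M, rfl⟩ := hsurj t
    have hM : realCoords M ∈ {x | ∀ p ∈ ({a, b} : Finset _), MvPolynomial.eval x p = 0} :=
      huniv ▸ Set.mem_univ _
    rw [h M, hM a (by simp), hM b (by simp)] at ht
    simp at ht
  · intro x hx
    let M : Matrix (Fin n) (Fin p) ℂ := Matrix.of fun i j =>
      ⟨x (Sum.inl (i, j)), x (Sum.inr (i, j))⟩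
    have hM : realCoords M = x := by
      funext s
      rcases s with s | s <;> rfl
    have h0 : MvPolynomial.eval (g M) q = 0 := by
      by_contra hne
      exact hx ⟨M, hne, hM⟩
    rw [h M, hM] at h0
    have hre := congrArg Complex.re h0
    have him := congrArg Complex.im h0
    simp at hre him
    intro p hp
    rcases Finset.mem_insert.1 hp with rfl | hp
    · exact hre
    · rw [Finset.mem_singleton.1 hp]
      exact him

theorem isGeneric_conjTranspose {n r : ℕ} {q : MvPolynomial (Fin r × Fin n) ℂ} (hq : q ≠ 0) :
    IsGeneric {W : Matrix (Fin n) (Fin r) ℂ |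
      MvPolynomial.eval (fun ij => Wᴴ ij.1 ij.2) q ≠ 0} := by
  have hg : ∀ ij : Fin r × Fin n,
      ∃ a b : MvPolynomial ((Fin n × Fin r) ⊕ (Fin n × Fin r)) ℝ,
        ∀ W : Matrix (Fin n) (Fin r) ℂ, Wᴴ ij.1 ij.2 =
          (MvPolynomial.eval (realCoords W) a : ℂ) +
            MvPolynomial.eval (realCoords W) b * Complex.I := fun ij =>
    ⟨MvPolynomial.X (Sum.inl (ij.2, ij.1)), -MvPolynomial.X (Sum.inr (ij.2, ij.1)), fun W => by
      rw [map_neg, MvPolynomial.eval_X, MvPolynomial.eval_X]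
      apply Complex.ext <;> simp [realCoords]⟩
  have hsurj : Function.Surjective
      fun (W : Matrix (Fin n) (Fin r) ℂ) (ij : Fin r × Fin n) => Wᴴ ij.1 ij.2 := fun t =>
    ⟨Matrix.of fun j i => star (t (i, j)), funext fun ij => by
      simp only [Matrix.conjTranspose_apply, Matrix.of_apply, star_star]⟩
  exact isGeneric_of_polynomial _ hg hsurj hq

theorem isGeneric_upperRows_transpose {n m r : ℕ} (hmn : m ≤ n)
    {q : MvPolynomial (Fin r × Fin m) ℂ} (hq : q ≠ 0) :
    IsGeneric {Z : Matrix (Fin n) (Fin r) ℂ |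
      MvPolynomial.eval (fun ij => (upperRows hmn Z)ᵀ ij.1 ij.2) q ≠ 0} := by
  have hg : ∀ ij : Fin r × Fin m,
      ∃ a b : MvPolynomial ((Fin n × Fin r) ⊕ (Fin n × Fin r)) ℝ,
        ∀ Z : Matrix (Fin n) (Fin r) ℂ, (upperRows hmn Z)ᵀ ij.1 ij.2 =
          (MvPolynomial.eval (realCoords Z) a : ℂ) +
            MvPolynomial.eval (realCoords Z) b * Complex.I := fun ij =>
    ⟨MvPolynomial.X (Sum.inl (Fin.castLE hmn ij.2, ij.1)),
      MvPolynomial.X (Sum.inr (Fin.castLE hmn ij.2, ij.1)), fun Z => by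
      rw [MvPolynomial.eval_X, MvPolynomial.eval_X]
      apply Complex.ext <;> simp [realCoords, upperRows]⟩
  have hsurj : Function.Surjective
      fun (Z : Matrix (Fin n) (Fin r) ℂ) (ij : Fin r × Fin m) =>
        (upperRows hmn Z)ᵀ ij.1 ij.2 := fun t =>
    ⟨Matrix.of fun a i => if h : (a : ℕ) < m then t (i, ⟨a, h⟩) else 0, funext fun ij => by
      simp only [upperRows, Matrix.transpose_apply, Matrix.submatrix_apply, Matrix.of_apply,
        Fin.val_castLE, Fin.is_lt, dif_pos, Fin.eta, id]⟩
  exact isGeneric_of_polynomial _ hg hsurj hq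

/-- If `M` has rank `r`, then `M Xᵀ` has full column rank for generic `X` with `r` rows. -/
theorem exists_polynomial_mul_transpose_injective {n m r : ℕ} (M : Matrix (Fin n) (Fin m) ℂ)
    (hM : M.rank = r) :
    ∃ q : MvPolynomial (Fin r × Fin m) ℂ, q ≠ 0 ∧
      ∀ X : Matrix (Fin r) (Fin m) ℂ, MvPolynomial.eval (fun ij => X ij.1 ij.2) q ≠ 0 →
        ∀ x, (M * Xᵀ) *ᵥ x = 0 → x = 0 := by
  subst hM
  obtain ⟨-, -, G, H, -, h⟩ := exists_rank_factorization M
  let N : Matrix (Fin m) (Fin M.rank) (MvPolynomial (Fin M.rank × Fin m) ℂ) :=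
    (G * M)ᵀ.map MvPolynomial.C
  have heval : ∀ X : Matrix (Fin M.rank) (Fin m) ℂ, MvPolynomial.eval (fun ij => X ij.1 ij.2)
      (Matrix.mvPolynomialX (Fin M.rank) (Fin m) ℂ * N).det = (G * (M * Xᵀ)).det := by
    intro X
    let φ : MvPolynomial (Fin M.rank × Fin m) ℂ →+* ℂ :=
      MvPolynomial.eval (fun ij => X ij.1 ij.2)
    have h1 : (Matrix.mvPolynomialX (Fin M.rank) (Fin m) ℂ).map φ = X := by
      ext i j
      simp [φ, Matrix.mvPolynomialX_apply]
    have h2 : N.map φ = (G * M)ᵀ := by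
      ext i j
      simp only [N, Matrix.map_apply, φ, MvPolynomial.eval_C]
    have h3 : (Matrix.mvPolynomialX (Fin M.rank) (Fin m) ℂ * N).map φ = X * (G * M)ᵀ := by
      rw [Matrix.map_mul, h1, h2]
    have h4 : φ (Matrix.mvPolynomialX (Fin M.rank) (Fin m) ℂ * N).det = (X * (G * M)ᵀ).det := by
      rw [← h3]
      exact RingHom.map_det φ _
    refine h4.trans ?_
    rw [← Matrix.det_transpose, Matrix.transpose_mul, Matrix.transpose_transpose, Matrix.mul_assoc]
  refine ⟨(Matrix.mvPolynomialX (Fin M.rank) (Fin m) ℂ * N).det, fun h0 => ?_,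
    fun X hX x hx => ?_⟩
  -- At X = Hᵀ the determinant is det (G M H) = 1.
  · have h1 := heval Hᵀ
    rw [h0, map_zero, Matrix.transpose_transpose, ← Matrix.mul_assoc, h, Matrix.det_one] at h1
    exact zero_ne_one h1
  · rw [heval X] at hX
    refine Matrix.eq_zero_of_mulVec_eq_zero hX ?_
    rw [← Matrix.mulVec_mulVec, hx, Matrix.mulVec_zero]

end Genericity

/-! ### Kernels under rank-preserving products, and orthogonal complements. -/

section LinearAlgebra

/-- The kernel of K lies in that of G K, and equal ranks give equal dimensions. -/
theorem mulVec_eq_zero_of_rank_mul_eq {ι κ ρ : Type*} [Fintype ι] [Fintype κ] [Fintype ρ]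
    {G : Matrix ρ ι ℂ} {K : Matrix ι κ ℂ} (h : (G * K).rank = K.rank) {x : κ → ℂ}
    (hx : (G * K) *ᵥ x = 0) : K *ᵥ x = 0 := by
  have hle : LinearMap.ker K.mulVecLin ≤ LinearMap.ker (G * K).mulVecLin := by
    intro v hv
    have hv' : K *ᵥ v = 0 := hv
    change (G * K) *ᵥ v = 0
    rw [← Matrix.mulVec_mulVec, hv', Matrix.mulVec_zero]
  have h1 := LinearMap.finrank_range_add_finrank_ker K.mulVecLin
  have h2 := LinearMap.finrank_range_add_finrank_ker (G * K).mulVecLin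
  have h3 : Module.finrank ℂ (LinearMap.range (G * K).mulVecLin) =
    Module.finrank ℂ (LinearMap.range K.mulVecLin) := h
  have h4 := Submodule.eq_of_le_of_finrank_eq hle (by omega)
  have h5 : x ∈ LinearMap.ker (G * K).mulVecLin := hx
  rw [← h4] at h5
  exact h5

theorem vecMul_eq_zero_of_rank_mul_eq {ι κ ρ : Type*} [Fintype ι] [Fintype κ] [Fintype ρ]
    {K : Matrix ι κ ℂ} {G : Matrix κ ρ ℂ} (h : (K * G).rank = K.rank) {x : ι → ℂ}
    (hx : x ᵥ* (K * G) = 0) : x ᵥ* K = 0 := by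
  rw [← Matrix.mulVec_transpose] at hx ⊢
  rw [Matrix.transpose_mul] at hx
  refine mulVec_eq_zero_of_rank_mul_eq ?_ hx
  rw [← Matrix.transpose_mul, Matrix.rank_transpose, Matrix.rank_transpose, h]

open scoped ComplexOrder in
theorem IsOrthComplBasis.eq_zero {n p k : ℕ} {M : Matrix (Fin n) (Fin p) ℂ}
    {N : Matrix (Fin n) (Fin k) ℂ} (h : IsOrthComplBasis M N) {v : Fin n → ℂ}
    (hM : Mᴴ *ᵥ v = 0) (hN : Nᴴ *ᵥ v = 0) : v = 0 := by
  have h1 : v ∈ Submodule.span ℂ (Set.range fun j : Fin k => N.col j) := by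
    refine (h.2 v).2 fun u => ?_
    rw [Matrix.star_mulVec, ← Matrix.dotProduct_mulVec, hM, dotProduct_zero]
  have h2 : ∀ u ∈ Submodule.span ℂ (Set.range fun j : Fin k => N.col j), star u ⬝ᵥ v = 0 := by
    intro u hu
    induction hu using Submodule.span_induction with
    | mem u hu =>
      obtain ⟨j, rfl⟩ := hu
      exact congrFun hN j
    | zero => simp
    | add u u' _ _ h h' => rw [star_add, add_dotProduct, h, h', add_zero]
    | smul c u _ h => rw [star_smul, smul_dotProduct, h, smul_zero]
  exact dotProduct_star_self_eq_zero.1 (h2 v h1)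

theorem IsOrthComplBasis.eq_zero_of_upperRows {n m p k : ℕ} {hmn : m ≤ n}
    {M : Matrix (Fin n) (Fin p) ℂ} {N : Matrix (Fin n) (Fin k) ℂ} (h : IsOrthComplBasis M N)
    {u : Fin m → ℂ} (hM : u ᵥ* upperRows hmn M = 0) (hN : u ᵥ* upperRows hmn N = 0) : u = 0 := by
  -- The conjugate of u padded by zeros: pairing with it sees only the upper rows, so v is
  -- orthogonal to all columns of both M and N.
  let v : Fin n → ℂ := fun a => if h : (a : ℕ) < m then star (u ⟨a, h⟩) else 0
  have hv : ∀ i : Fin m, v (Fin.castLE hmn i) = star (u i) := fun i => by simp [v]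
  have key : ∀ {q : ℕ} (T : Matrix (Fin n) (Fin q) ℂ), u ᵥ* upperRows hmn T = 0 → Tᴴ *ᵥ v = 0 := by
    intro q T hT
    funext j
    have h1 := congrArg star (congrFun hT j)
    simp only [Pi.zero_apply, star_zero] at h1 ⊢
    rw [← h1, Matrix.mulVec, Matrix.vecMul, dotProduct, dotProduct, star_sum]
    symm
    refine Finset.sum_of_injOn (Fin.castLE hmn) (Fin.castLE_injective hmn).injOn
      (fun _ _ => Finset.mem_coe.2 (Finset.mem_univ _)) (fun a _ ha => ?_) fun i _ => ?_
    · have : ¬ (a : ℕ) < m := fun hlt => ha ⟨⟨a, hlt⟩, by simp, rfl⟩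
      simp [v, this]
    · rw [hv]
      simp [upperRows, mul_comm]
  have hv0 := h.eq_zero (key M hM) (key N hN)
  funext i
  have := congrFun hv0 (Fin.castLE hmn i)
  rw [hv] at this
  simpa using this

end LinearAlgebra

/-! ### Added simple eigenvalues, and regularity of forms without singular blocks. -/

section SimpleBlocks

theorem isBlockEigenvalue_append {R R' : List RegularBlock} {μ : OnePoint ℂ} :
    IsBlockEigenvalue (R ++ R') μ ↔ IsBlockEigenvalue R μ ∨ IsBlockEigenvalue R' μ := by
  simp [IsBlockEigenvalue, or_and_right, exists_or]

theorem isBlockEigenvalue_map_simpleBlock {ds : List ℂ} {μ : OnePoint ℂ} :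
    IsBlockEigenvalue (ds.map simpleBlock) μ ↔ ∃ c ∈ ds, (c : OnePoint ℂ) = μ := by
  simp [IsBlockEigenvalue, simpleBlock]

theorem isSimpleBlockEigenvalue_map_simpleBlock {ds : List ℂ} (hds : ds.Nodup) {μ : OnePoint ℂ}
    (hμ : IsBlockEigenvalue (ds.map simpleBlock) μ) :
    IsSimpleBlockEigenvalue (ds.map simpleBlock) μ := by
  have hinj : Function.Injective simpleBlock := fun c c' h =>
    OnePoint.coe_injective (congrArg RegularBlock.eigenvalue h)
  have hnd : (ds.map simpleBlock).Nodup := hds.map hinj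
  have hget : ∀ j, ∃ c, (ds.map simpleBlock).get j = simpleBlock c := fun j => by
    obtain ⟨c, -, hc⟩ := List.mem_map.1 (List.get_mem (ds.map simpleBlock) j)
    exact ⟨c, hc.symm⟩
  obtain ⟨b, hb, hbμ⟩ := hμ
  obtain ⟨i, rfl⟩ := List.get_of_mem hb
  obtain ⟨c, hc⟩ := hget i
  refine ⟨i, by rw [hc]; rfl, fun j => ⟨fun hj => ?_, fun hj => hj ▸ hbμ⟩⟩
  obtain ⟨c', hc'⟩ := hget j
  apply List.nodup_iff_injective_get.1 hnd
  rw [hc'] at hj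
  rw [hc] at hbμ
  rw [hc, hc']
  exact congrArg simpleBlock (OnePoint.coe_injective (hj.trans hbμ.symm))

variable {n m : ℕ} {A B : Matrix (Fin n) (Fin m) ℂ} {R : List RegularBlock} {rt lf : List ℕ}

theorem HasKroneckerForm.card_rows (h : HasKroneckerForm A B R rt []) :
    n = (R.map RegularBlock.size).sum + rt.sum := by
  obtain ⟨e, -⟩ := h
  have h1 := Fintype.card_congr e
  rw [Fintype.card_fin, Fintype.card_sigma] at h1
  simp only [Fintype.card_fin] at h1
  rw [h1, sum_get _ KroneckerBlock.rows]
  simp only [kroneckerBlocks, List.map_append, List.map_map, List.sum_append, List.map_nil,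
    List.sum_nil, add_zero]
  have h2 : (rt.map (KroneckerBlock.rows ∘ KroneckerBlock.right)).sum = rt.sum :=
    congrArg List.sum (List.map_id' rt)
  rw [h2]
  rfl

theorem HasKroneckerForm.rank_of_not_isBlockEigenvalue (h : HasKroneckerForm A B R rt lf)
    {μ : OnePoint ℂ} (hμ : ¬ IsBlockEigenvalue R μ) : (pencilAt A B μ).rank = normalRank A B := by
  classical
  have h1 := h.rank_add_countP μ
  rw [countP_eigenvalue_eq_zero.2 hμ] at h1
  rw [h.normalRank_eq, ← h1, add_zero]

theorem HasKroneckerForm.isRegularPencil {A B : Matrix (Fin n) (Fin n) ℂ}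
    (h : HasKroneckerForm A B R [] []) : IsRegularPencil A B := by
  obtain ⟨ζ, hζ⟩ := exists_not_isBlockEigenvalue R
  refine ⟨ζ, ?_⟩
  have h1 := h.rank_of_not_isBlockEigenvalue hζ
  have h3 := h.card_rows
  rw [h.normalRank_eq] at h1
  simp only [List.sum_nil, add_zero] at h1 h3
  rw [← h3] at h1
  have h2 := mulVec_surjective_of_rank (M := A - ζ • B) (by rw [Fintype.card_fin]; exact h1)
  exact ((Matrix.isUnit_iff_isUnit_det _).1 (Matrix.mulVec_surjective_iff_isUnit.1 h2)).ne_zero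

end SimpleBlocks

/-! ### Rank comparison and generic right multiplication. -/

section Compression

variable {n m n' m' : ℕ} {A B : Matrix (Fin n) (Fin m) ℂ} {A' B' : Matrix (Fin n') (Fin m') ℂ}
  {R R' : List RegularBlock} {rt lf rt' lf' : List ℕ}

/-- Both pencils have the same normal rank and the same number of blocks at μ, hence the same rank
there. -/
theorem HasKroneckerForm.rank_eq_of_append (h : HasKroneckerForm A B R rt lf)
    (h' : HasKroneckerForm A' B' (R ++ R') rt' lf') (hr : normalRank A' B' = normalRank A B)
    {μ : OnePoint ℂ} (hμ : ¬ IsBlockEigenvalue R' μ) :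
    (pencilAt A' B' μ).rank = (pencilAt A B μ).rank := by
  classical
  have h1 := h.rank_add_countP μ
  have h2 := h'.rank_add_countP μ
  rw [← h.normalRank_eq] at h1
  rw [← h'.normalRank_eq, List.countP_append, countP_eigenvalue_eq_zero.2 hμ] at h2
  omega

theorem HasKroneckerForm.normalRank_eq_card (h : HasKroneckerForm A B R rt []) :
    normalRank A B = n := by
  rw [h.normalRank_eq, List.sum_nil, add_zero, ← h.card_rows]

theorem pencilAt_mul_mul (G : Matrix (Fin n') (Fin n) ℂ) (K : Matrix (Fin m) (Fin m') ℂ)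
    (μ : OnePoint ℂ) : pencilAt (G * A * K) (G * B * K) μ = G * pencilAt A B μ * K :=
  pencilValue_mul_mul A B G K μ

theorem pencilAt_mul (G : Matrix (Fin n') (Fin n) ℂ) (μ : OnePoint ℂ) :
    pencilAt (G * A) (G * B) μ = G * pencilAt A B μ := by
  have h := pencilAt_mul_mul (A := A) (B := B) G (1 : Matrix (Fin m) (Fin m) ℂ) μ
  rwa [Matrix.mul_one, Matrix.mul_one, Matrix.mul_one] at h

/-- Generic compression of the columns of a pencil with linearly independent rows to a regular
pencil. At finitely many given points, the columns that are selected from another pencil of rank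
`r` stay linearly independent. -/
theorem HasKroneckerForm.exists_polynomial_mul_right {r : ℕ} {A₁ B₁ : Matrix (Fin r) (Fin m) ℂ}
    (h : HasKroneckerForm A₁ B₁ R rt []) (cs : List ℂ)
    (hcs : ∀ c ∈ cs, (pencilAt A B c).rank = r) :
    ∃ q : MvPolynomial (Fin r × Fin m) ℂ, q ≠ 0 ∧ ∀ Z : Matrix (Fin m) (Fin r) ℂ,
      MvPolynomial.eval (fun ij => Zᵀ ij.1 ij.2) q ≠ 0 →
        (∃ ds : List ℂ, ds.Nodup ∧ (∀ c ∈ ds, ¬ IsBlockEigenvalue R c) ∧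
          HasKroneckerForm (A₁ * Z) (B₁ * Z) (R ++ ds.map simpleBlock) [] []) ∧
        ∀ c ∈ cs, ∀ x, (pencilAt A B c * Z) *ᵥ x = 0 → x = 0 := by
  classical
  have hr : normalRank A₁ᵀ B₁ᵀ = r := by
    rw [h.transpose.normalRank_eq, ← h.normalRank_eq_card, h.normalRank_eq]
    simp
  obtain ⟨p, hp, hp'⟩ := h.transpose.exists_polynomial_mul_left hr
  choose! q hq hq' using fun c (hc : c ∈ cs) =>
    exists_polynomial_mul_transpose_injective (pencilAt A B c) (hcs c hc)
  -- The finitely many injectivity conditions and the condition on the Kronecker form hold together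
  -- where the product of their polynomials does not vanish.
  refine ⟨p * ∏ c ∈ cs.toFinset, q c,
    mul_ne_zero hp (Finset.prod_ne_zero_iff.2 fun c hc => hq c (List.mem_toFinset.1 hc)),
    fun Z hZ => ?_⟩
  rw [map_mul, map_prod] at hZ
  obtain ⟨ds, hnd, hds, hform⟩ := hp' Zᵀ (left_ne_zero_of_mul hZ)
  refine ⟨⟨ds, hnd, hds, ?_⟩, fun c hc x hx => ?_⟩
  · have := hform.transpose
    rwa [Matrix.transpose_mul, Matrix.transpose_mul, Matrix.transpose_transpose,
      Matrix.transpose_transpose, Matrix.transpose_transpose] at this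
  · refine hq' c hc Zᵀ
      (Finset.prod_ne_zero_iff.1 (right_ne_zero_of_mul hZ) c (List.mem_toFinset.2 hc)) x ?_
    rwa [Matrix.transpose_transpose]

theorem eq_zero_of_vecMul_eq_zero_of_rank {r : ℕ} {M : Matrix (Fin r) (Fin m) ℂ} (hM : M.rank = r)
    {v : Fin r → ℂ} (hv : v ᵥ* M = 0) : v = 0 := by
  obtain ⟨H, hH⟩ := exists_mul_eq_one_of_surjective
    (mulVec_surjective_of_rank (hM.trans (Fintype.card_fin r).symm))
  rw [← Matrix.vecMul_one v, ← hH, ← Matrix.vecMul_vecMul, hv, Matrix.zero_vecMul]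

end Compression

end MatrixPencil

end

/-! ### The main theorem. -/

theorem theorem4p2 (n m k : ℕ) (hmn : m ≤ n) (hkn : k ≤ n)
    (A B : Matrix (Fin n) (Fin m) ℂ) (hrank : normalRank A B = n - k) :
    (∃ R : List RegularBlock, IsRegularPart A B R) ∧
    ∀ R : List RegularBlock, IsRegularPart A B R →
      ∃ Ω : Set (Matrix (Fin n) (Fin (n - k)) ℂ), IsGeneric Ω ∧
        ∀ W ∈ Ω, ∃ Ω' : Set (Matrix (Fin n) (Fin (n - k)) ℂ), IsGeneric Ω' ∧
          ∀ Zhat ∈ Ω', ∀ Z : Matrix (Fin m) (Fin (n - k)) ℂ, Z = upperRows hmn Zhat →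
            (IsRegularPencil (Wᴴ * A * Z) (Wᴴ * B * Z) ∧
              ∃ Rran : List RegularBlock,
                HasKroneckerForm (Wᴴ * A * Z) (Wᴴ * B * Z) (R ++ Rran) [] [] ∧
                (∀ μ, IsBlockEigenvalue Rran μ → IsSimpleBlockEigenvalue Rran μ) ∧
                (∀ μ, IsBlockEigenvalue Rran μ → ¬ IsBlockEigenvalue R μ)) ∧
            (∀ Wperp Zhatperp : Matrix (Fin n) (Fin k) ℂ,
              IsOrthComplBasis W Wperp → IsOrthComplBasis Zhat Zhatperp →
              ∀ Zperp : Matrix (Fin m) (Fin k) ℂ, Zperp = upperRows hmn Zhatperp →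
              ∀ (μ : OnePoint ℂ) (x y : Fin (n - k) → ℂ),
                IsEigenvalue (Wᴴ * A * Z) (Wᴴ * B * Z) μ →
                IsRightEigenvector (Wᴴ * A * Z) (Wᴴ * B * Z) μ x →
                IsLeftEigenvector (Wᴴ * A * Z) (Wᴴ * B * Z) μ y →
                  (IsEigenvalue A B μ ↔ IsBlockEigenvalue R μ) ∧
                  (IsEigenvalue A B μ ↔
                    star y ᵥ* (Wᴴ * pencilAt A B μ * Zperp) = 0 ∧
                    (Wperpᴴ * pencilAt A B μ * Z) *ᵥ x = 0)) := by
  refine ⟨exists_isRegularPart A B, ?_⟩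
  rintro R ⟨rt, lf, h⟩
  obtain ⟨p, hp, hp'⟩ := h.exists_polynomial_mul_left hrank
  refine ⟨_, isGeneric_conjTranspose hp, fun W hW => ?_⟩
  obtain ⟨cs, hcs, hcsR, hrow⟩ := hp' Wᴴ hW
  -- The points `cs` created by W are not eigenvalues of R, so A - cB still has full normal rank
  -- there. The set Ω' depends on W through them.
  obtain ⟨q, hq, hq'⟩ := hrow.exists_polynomial_mul_right cs
    (fun c hc => (h.rank_of_not_isBlockEigenvalue (hcsR c hc)).trans hrank)
  refine ⟨_, isGeneric_upperRows_transpose hmn hq, ?_⟩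
  rintro Zhat hZhat Z rfl
  obtain ⟨⟨ds, hds, hdsR, hform⟩, hinj⟩ := hq' _ hZhat
  rw [List.append_assoc, ← List.map_append] at hform
  have hdscs : ∀ c ∈ ds, c ∉ cs := fun c hc hc' => hdsR c hc
    (isBlockEigenvalue_append.2 (.inr (isBlockEigenvalue_map_simpleBlock.2 ⟨c, hc', rfl⟩)))
  have hnodup : (cs ++ ds).Nodup :=
    List.nodup_append'.2 ⟨hcs, hds, fun c hc hc' => hdscs c hc' hc⟩
  have hdisj : ∀ μ, IsBlockEigenvalue ((cs ++ ds).map simpleBlock) μ →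
      ¬ IsBlockEigenvalue R μ := by
    intro μ hμ
    obtain ⟨c, hc, rfl⟩ := isBlockEigenvalue_map_simpleBlock.1 hμ
    rcases List.mem_append.1 hc with hc | hc
    · exact hcsR c hc
    · exact fun hR => hdsR c hc (isBlockEigenvalue_append.2 (.inl hR))
  refine ⟨⟨hform.isRegularPencil, _, hform,
    fun μ => isSimpleBlockEigenvalue_map_simpleBlock hnodup, hdisj⟩, ?_⟩
  rintro Wperp Zhatperp hWperp hZhatperp _ rfl μ x y hμ ⟨hx, hx0⟩ ⟨hy, hy0⟩
  refine ⟨h.isEigenvalue_iff μ, ?_⟩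
  rw [h.isEigenvalue_iff μ]
  rw [pencilAt_mul_mul] at hx0 hy0
  constructor
  · intro hR
    have hran : ¬ IsBlockEigenvalue ((cs ++ ds).map simpleBlock) μ := fun hμ' => hdisj μ hμ' hR
    -- The compression at μ has the same rank as the original pencil, so both one-sided products in
    -- between have that rank too.
    have hrk := h.rank_eq_of_append hform (hform.normalRank_eq_card.trans hrank.symm) hran
    rw [pencilAt_mul_mul] at hrk
    have hl : (Wᴴ * pencilAt A B μ * upperRows hmn Zhat).rank ≤ (Wᴴ * pencilAt A B μ).rank :=
      Matrix.rank_mul_le_left _ _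
    have hl' : (Wᴴ * pencilAt A B μ).rank ≤ (pencilAt A B μ).rank := Matrix.rank_mul_le_right _ _
    have hr' : (pencilAt A B μ * upperRows hmn Zhat).rank ≤ (pencilAt A B μ).rank :=
      Matrix.rank_mul_le_left _ _
    have hr : (Wᴴ * (pencilAt A B μ * upperRows hmn Zhat)).rank ≤
        (pencilAt A B μ * upperRows hmn Zhat).rank := Matrix.rank_mul_le_right _ _
    constructor
    · rw [← Matrix.vecMul_vecMul, vecMul_eq_zero_of_rank_mul_eq (by omega) hy0,
        Matrix.zero_vecMul]
    · rw [Matrix.mul_assoc] at hx0 hrk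
      rw [Matrix.mul_assoc, ← Matrix.mulVec_mulVec,
        mulVec_eq_zero_of_rank_mul_eq (by omega) hx0, Matrix.mulVec_zero]
  · rintro ⟨hyZ, hWx⟩
    rcases isBlockEigenvalue_append.1 ((hform.isEigenvalue_iff μ).1 hμ) with hR | hran
    · exact hR
    exfalso
    obtain ⟨c, hc, rfl⟩ := isBlockEigenvalue_map_simpleBlock.1 hran
    rcases List.mem_append.1 hc with hc | hc
    -- Eigenvalue created by W: the vector (A - cB) Z x is orthogonal to the columns of W and of its
    -- complement, hence zero, and (A - cB) Z is injective.
    · rw [Matrix.mul_assoc, ← Matrix.mulVec_mulVec] at hx0 hWx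
      exact hx (hinj c hc x (hWperp.eq_zero hx0 hWx))
    -- Eigenvalue created by Z: W*(A - cB) has full row rank, and y*W*(A - cB) annihilates the upper
    -- rows of both Ẑ and its complement.
    · rw [← Matrix.vecMul_vecMul] at hy0 hyZ
      have hrk := hrow.rank_of_not_isBlockEigenvalue (hdsR c hc)
      rw [hrow.normalRank_eq_card, pencilAt_mul] at hrk
      exact hy (star_eq_zero.1
        (eq_zero_of_vecMul_eq_zero_of_rank hrk (hZhatperp.eq_zero_of_upperRows hy0 hyZ)))
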